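/- **Proposition (bias and variance of the kernel two-point estimator).** Fix $\beta\ge 2$, $\ell=\lfloor\beta\rfloor$, and a smoothing kernel $K:[-1,1]\to\mathbb{R}$. With $r\sim\mathrm{Unif}([-1,1])$ this means: $\mathbb{E}[K(r)]=0$, $\mathbb{E}[rK(r)]=1$, $\kappa_\beta=\mathbb{E}[|r|^\beta|K(r)|]<\infty$, $\kappa=\mathbb{E}[K(r)^2]<\infty$ and, if $\beta>2$, $\mathbb{E}[r^jK(r)]=0$ for $j=2,\dots,\ell$ (for example $K(r)=3r$ for $\beta=2$). There is a constant $C>0$, depending only on $\beta$ and $K$, such that the following holds for every $d\ge1$, $L\in\mathbb{R}$, $h>0$, $\delta_k\ge0$. Let $f:\mathbb{R}^d\to\mathbb{R}$ be $\ell$ times continuously differentiable with $\|f^{(\ell)}(x)-f^{(\ell)}(z)\|\le L\|x-z\|^{\beta-\ell}$ for all $x,z$. Let $\mathcal F$ be the $\sigma$-algebra of the history of the algorithm and $x_k$ an $\mathcal F$-measurable iterate. Let $r\sim\mathrm{Unif}([-1,1])$ and $\zeta$, uniform on the unit sphere of $\mathbb{R}^d$, be independent of each other and jointly independent of $\mathcal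 F$. Put $x_k^\pm=x_k\pm hr\zeta$. The oracle returns $\hat f(x_k^\pm)=f(x_k^\pm)+\xi^\pm$ with noise of level $\delta_k$: each of $\xi^+,\xi^-$ is either Tsybakov noise, $\mathbb{E}[(\xi^\pm)^2\mid\mathcal F]\le\delta_k^2$, or adversarial noise, that is, a deterministic function of the queried point $x_k^\pm$ bounded by $\delta_k$ in absolute value. Let $$g_k=\frac{d}{2h}\bigl(\hat f(x_k^+)-\hat f(x_k^-)\bigr)K(r)\zeta,\qquad g_k^0=\frac{d}{2h}\bigl(f(x_k^+)-f(x_k^-)\bigr)K(r)\zeta .$$ Then, almost surely: 1. (Bias) $\mathbb{E}[g_k\mid\mathcal F]=\nabla f(x_k)+b_k$, where $\mathbb{E}[\|g_k\|\mid\mathcal F]<\infty$ and $\|b_k\|\le C\bigl(Lh^{\beta-1}+\frac dh\,\delta_k\bigr)$. 2. (Second moment) If $K$ is bounded, then $$\mathbb{E}[\|g_k\|^2\mid\mathcal F]\le C\,\frac{d^2}{h^2}\,\mathbb{E}\bigl[|f(x_k^+)-f(x_k^-)|^2\mid\mathcal F\bigr]+C\,\frac{d^2}{h^2}\,\delta_k^2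 .$$ 3. (Second moment, general kernel) If $K$ is not necessarily bounded, but the noises $\xi^\pm$ have level $\delta_k$ also given the queried points (with $\mathcal F$ replaced by $\mathcal F\vee\sigma(r,\zeta)$ in the Tsybakov condition), then $$\mathbb{E}[\|g_k\|^2\mid\mathcal F]\le C\,\mathbb{E}\bigl[\|g_k^0\|^2\mid\mathcal F\bigr]+C\,\frac{d^2}{h^2}\,\delta_k^2 .$$ -/

import Mathlib

open MeasureTheory ProbabilityTheory
open scoped ENNReal

/-- Euclidean space `ℝ^d`. -/
abbrev Eucl (d : ℕ) : Type := EuclideanSpace ℝ (Fin d)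

/-- The uniform probability distribution on `[-1, 1]`. -/
noncomputable def unifInterval : Measure ℝ := ProbabilityTheory.cond volume (Set.Icc (-1 : ℝ) 1)

/-- Smoothing kernels of order `β`. Only the values of `K` on `[-1, 1]` matter. All moments are taken
under the uniform law of `r` on `[-1, 1]`, that is, with respect to `dr / 2`. For `β = 2` the kernel
`K r = 3 * r` is an example. -/
structure IsSmoothingKernel (β : ℝ) (K : ℝ → ℝ) : Prop where
  /-- `κ = E |K(r)|²` is finite. -/
  sq_integrable : MemLp K 2 unifInterval
  /-- `κ_β = E |r|^β |K(r)|` is finite. -/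
  integrable_rpow : Integrable (fun r => |r| ^ β * |K r|) unifInterval
  moment_zero : ∫ r, K r ∂unifInterval = 0
  moment_one : ∫ r, r * K r ∂unifInterval = 1
  higher_moments : 2 < β → ∀ j : ℕ, 2 ≤ j → j ≤ ⌊β⌋₊ → ∫ r, r ^ j * K r ∂unifInterval = 0

/-- The class `F_β(L)`: `f` is `ℓ = ⌊β⌋` times continuously differentiable and its `ℓ`-th derivative
is Hölder continuous with exponent `β - ℓ` and constant `L`. -/
structure HolderSmooth {d : ℕ} (β L : ℝ) (f : Eucl d → ℝ) : Prop where
  contDiff : ContDiff ℝ (⌊β⌋₊ : ℕ) f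
  holder : ∀ x z : Eucl d,
    ‖iteratedFDeriv ℝ ⌊β⌋₊ f x - iteratedFDeriv ℝ ⌊β⌋₊ f z‖ ≤ L * ‖x - z‖ ^ (β - (⌊β⌋₊ : ℝ))

/-- Tsybakov noise of level `δ`, given the information `m`: `E[ξ² | m] ≤ δ²` almost surely. -/
def IsTsybakovNoise {Ω : Type*} {m0 : MeasurableSpace Ω} (μ : Measure[m0] Ω) (m : MeasurableSpace Ω)
    (ξ : Ω → ℝ) (δ : ℝ) : Prop :=
  ∀ᵐ ω ∂μ, μ⁻[fun ω' => ENNReal.ofReal (ξ ω' ^ 2)|m] ω ≤ ENNReal.ofReal (δ ^ 2)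

/-- Adversarial noise of level `δ`: the noise is a deterministic function of the queried point `q`,
bounded by `δ` in absolute value. -/
def IsAdversarialNoise {Ω : Type*} {d : ℕ} (q : Ω → Eucl d) (ξ : Ω → ℝ) (δ : ℝ) : Prop :=
  ∃ e : Eucl d → ℝ, (∀ y, |e y| ≤ δ) ∧ ∀ ω, ξ ω = e (q ω)

/-- The noise `ξ` of the query at `q` has level `δ` given the information `m`, in one of the two
noise models. -/
def HasNoiseLevel {Ω : Type*} {m0 : MeasurableSpace Ω} {d : ℕ} (μ : Measure[m0] Ω)
    (m : MeasurableSpace Ω) (q : Ω → Eucl d) (ξ : Ω → ℝ) (δ : ℝ) : Prop :=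
  IsTsybakovNoise μ m ξ δ ∨ IsAdversarialNoise q ξ δ

/-- The query points `x⁺ = x + h r ζ` (for `s = 1`) and `x⁻ = x - h r ζ` (for `s = -1`). -/
noncomputable def queryPoint {d : ℕ} (s h r : ℝ) (ζ : Metric.sphere (0 : Eucl d) 1)
    (x : Eucl d) : Eucl d :=
  x + (s * (h * r)) • (ζ : Eucl d)

/-- The kernel two-point estimator `(d / (2h)) (y⁺ - y⁻) K(r) ζ`, computed from the oracle values
`y⁺` and `y⁻` at the two query points. -/
noncomputable def twoPointEstimator {d : ℕ} (K : ℝ → ℝ) (h r : ℝ)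
    (ζ : Metric.sphere (0 : Eucl d) 1) (yp ym : ℝ) : Eucl d :=
  ((d : ℝ) / (2 * h) * (yp - ym) * K r) • (ζ : Eucl d)

/-- `Y` is (a version of) the conditional expectation `E[X | m]`, for a random vector `X` that is
only required to be conditionally integrable: `E[‖X‖ | m] < ∞` almost surely. -/
structure HasCondMean {Ω E : Type*} [NormedAddCommGroup E] [NormedSpace ℝ E]
    {m0 : MeasurableSpace Ω} (μ : Measure[m0] Ω) (m : MeasurableSpace Ω) (X Y : Ω → E) : Prop where
  aestronglyMeasurable : AEStronglyMeasurable[m0] X μ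
  aestronglyMeasurable_mean : AEStronglyMeasurable[m] Y μ
  finite : ∀ᵐ ω ∂μ, μ⁻[fun ω' => ‖X ω'‖ₑ|m] ω < ∞
  integrableOn : ∀ s, MeasurableSet[m] s → IntegrableOn X s μ → IntegrableOn Y s μ
  setIntegral_eq : ∀ s, MeasurableSet[m] s → IntegrableOn X s μ →
    ∫ ω in s, Y ω ∂μ = ∫ ω in s, X ω ∂μ

/-- For an integrable `X` this is the usual conditional expectation. -/
theorem HasCondMean.ae_eq_condExp {Ω E : Type*} [NormedAddCommGroup E] [NormedSpace ℝ E]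
    [CompleteSpace E] {m0 : MeasurableSpace Ω} {μ : Measure Ω} [IsFiniteMeasure μ]
    {m : MeasurableSpace Ω} (hm : m ≤ m0) {X Y : Ω → E} (h : HasCondMean μ m X Y)
    (hX : Integrable X μ) : Y =ᵐ[μ] μ[X|m] :=
  ae_eq_condExp_of_forall_setIntegral_eq hm hX
    (fun s hs _ => h.integrableOn s hs hX.integrableOn)
    (fun s hs _ => h.setIntegral_eq s hs hX.integrableOn) h.aestronglyMeasurable_mean

/-!
The point of the bias bound is that its constant does not depend on the dimension, although the
estimator carries a factor `d`. That factor is absorbed by integration by parts on the unit sphere,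
`d ∫ φ ζ_u = ∫ (∂_u φ + ζ_u (φ - ∂_ζ φ))`, where `ζ_u = ⟪u, ζ⟫`
(`natCast_mul_integral_mul_inner_unifSphere`). It is proved without the divergence theorem: the
uniform law is invariant under `exp (t A)` for skew-symmetric `A`, so the derivative of `φ ⟪w, ·⟫`
along the rotation field in the plane of `u` and `w` has mean zero, and summation over an
orthonormal basis of vectors `w` gives the identity.

Applied to `φ z = f (x + s z)`, it turns `d f (x + s ζ) ζ_u` into `sphericalPart`, a function of `s`
whose Taylor expansion at `0` has the linear coefficient `D f(x) u` for every direction `ζ`, and a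
remainder of at most `2 L |s|^β` (`exists_taylor_sphericalPart`). Integration of the odd difference
of this function against the kernel leaves only the linear term: even terms cancel, and the higher
odd ones are removed by the moment conditions (`IsSmoothingKernel.abs_integral_sub_le`). So the
average of the noise-free estimator over the draw is within `2 L h^(β-1) E[|r|^β |K(r)|]` of the
gradient (`norm_integral_estimatorAt_sub_gradient_le`).

The fresh draw is independent of the history, so conditioning on the history amounts to freezing the
iterate and averaging over the draw (`map_prodMk_restrict_of_indep`). Adversarial noise is a case of
Tsybakov noise, and `E[|ξ K(r)| | F] ≤ δ (1 + E[K(r)²]) / 2` bounds the noise part of the bias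
(`condLExp_abs_mul_le`). The second moments follow from `(a + p - q)² ≤ 3 (a² + p² + q²)`, together
with `E[ξ² K(r)² | F] ≤ δ² E[K(r)²]` when the noise has level `δ` given the draw
(`IsTsybakovNoise.condLExp_mul_comp_le`).
-/

open scoped RealInnerProductSpace

/-! ### The uniform law on the sphere -/

/-- The uniform probability distribution on the unit sphere of `ℝ^d`. -/
noncomputable def unifSphere (d : ℕ) : Measure (Metric.sphere (0 : Eucl d) 1) :=
  ProbabilityTheory.cond (volume : Measure (Eucl d)).toSphere Set.univ

theorem isProbabilityMeasure_unifSphere {d : ℕ} (hd : 1 ≤ d) :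
    IsProbabilityMeasure (unifSphere d) := by
  have : Nonempty (Fin d) := ⟨⟨0, hd⟩⟩
  refine ProbabilityTheory.cond_isProbabilityMeasure ?_
  rw [Measure.measure_univ_ne_zero]
  exact Measure.toSphere_ne_zero _

/-- The action of a linear isometry on the unit sphere. -/
noncomputable def sphereMap {d : ℕ} (R : Eucl d ≃ₗᵢ[ℝ] Eucl d) (ζ : Metric.sphere (0 : Eucl d) 1) :
    Metric.sphere (0 : Eucl d) 1 :=
  ⟨R ζ, by simp⟩

theorem continuous_sphereMap {d : ℕ} (R : Eucl d ≃ₗᵢ[ℝ] Eucl d) : Continuous (sphereMap R) :=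
  (R.continuous.comp continuous_subtype_val).subtype_mk _

open scoped Pointwise in
theorem measurePreserving_sphereMap {d : ℕ} (R : Eucl d ≃ₗᵢ[ℝ] Eucl d) :
    MeasurePreserving (sphereMap R) (unifSphere d) (unifSphere d) := by
  have hm := (continuous_sphereMap R).measurable
  refine ⟨hm, ?_⟩
  have key : (volume : Measure (Eucl d)).toSphere.map (sphereMap R)
      = (volume : Measure (Eucl d)).toSphere := by
    ext s hs
    rw [Measure.map_apply hm hs, Measure.toSphere_apply' _ (hm hs), Measure.toSphere_apply' _ hs]
    congr 1
    rw [← R.measurePreserving.measure_preimage_equiv (f := R.toMeasurableEquiv)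
      (Set.Ioo (0 : ℝ) 1 • ((↑) '' s : Set (Eucl d)))]
    congr 1
    ext z
    simp only [Set.mem_smul, Set.mem_image, Set.mem_preimage, Subtype.exists, exists_and_right,
      exists_eq_right]
    constructor
    · rintro ⟨a, ha, y, ⟨hy, hys⟩, rfl⟩
      exact ⟨a, ha, R y, ⟨by simpa using hy, hys⟩, (R.map_smul a y).symm⟩
    · rintro ⟨a, ha, y, ⟨hy, hys⟩, hz⟩
      change a • y = R z at hz
      refine ⟨a, ha, R.symm y, ⟨by simpa using hy, ?_⟩, ?_⟩
      · simpa [sphereMap] using hys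
      · apply R.injective
        simpa using hz
  simp only [unifSphere, ProbabilityTheory.cond, Measure.restrict_univ, Measure.map_smul, key]

theorem integral_comp_isometry_unifSphere {d : ℕ} (R : Eucl d ≃ₗᵢ[ℝ] Eucl d) {φ : Eucl d → ℝ}
    (hφ : Continuous φ) : ∫ ζ, φ (R ζ) ∂unifSphere d = ∫ ζ, φ ζ ∂unifSphere d := by
  have h := measurePreserving_sphereMap R
  conv_rhs => rw [← h.map_eq]
  rw [integral_map h.measurable.aemeasurable]
  · rfl
  · exact (hφ.comp continuous_subtype_val).aestronglyMeasurable

theorem integrable_unifSphere {d : ℕ} (hd : 1 ≤ d) {φ : Metric.sphere (0 : Eucl d) 1 → ℝ}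
    (hφ : Continuous φ) : Integrable φ (unifSphere d) := by
  have := isProbabilityMeasure_unifSphere hd
  exact hφ.integrable_of_hasCompactSupport (HasCompactSupport.of_compactSpace _)

/-- Infinitesimal rotation invariance: the derivative of `φ` along the vector field of a
skew-symmetric map has mean zero on the sphere. -/
theorem integral_fderiv_skew_unifSphere {d : ℕ} (hd : 1 ≤ d) (A : Eucl d →L[ℝ] Eucl d)
    (hA : A ∈ skewAdjoint (Eucl d →L[ℝ] Eucl d)) {φ : Eucl d → ℝ} (hφ : ContDiff ℝ 1 φ) :
    ∫ ζ, fderiv ℝ φ ζ (A ζ) ∂unifSphere d = 0 := by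
  have := isProbabilityMeasure_unifSphere hd
  -- the exponential series on an algebra is set up over `ℚ`
  let _ : NormedAlgebra ℚ (Eucl d →L[ℝ] Eucl d) := NormedAlgebra.restrictScalars ℚ ℝ _
  let U : ℝ → (Eucl d →L[ℝ] Eucl d) := fun t => NormedSpace.exp (t • A)
  have hU : ∀ t, HasDerivAt U (U t * A) t := fun t => hasDerivAt_exp_smul_const A t
  have hUc : Continuous U := continuous_iff_continuousAt.2 fun t => (hU t).continuousAt
  -- the exponential of a skew-symmetric map is orthogonal, so `t ↦ ∫ φ (U t ζ)` is constant
  have hUmem : ∀ t, U t ∈ unitary (Eucl d →L[ℝ] Eucl d) := fun t =>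
    NormedSpace.exp_mem_unitary_of_mem_skewAdjoint (skewAdjoint.smul_mem t hA)
  have hconst : ∀ t, ∫ ζ, φ (U t ζ) ∂unifSphere d = ∫ ζ, φ ζ ∂unifSphere d := fun t =>
    integral_comp_isometry_unifSphere (Unitary.linearIsometryEquiv ⟨U t, hUmem t⟩) hφ.continuous
  have hD : ∀ (t : ℝ) (z : Eucl d),
      HasDerivAt (fun t => φ (U t z)) (fderiv ℝ φ (U t z) ((U t * A) z)) t := fun t z =>
    ((hφ.differentiable one_ne_zero) (U t z)).hasFDerivAt.comp_hasDerivAt t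
      ((hU t).clm_apply (hasDerivAt_const t z) |>.congr_deriv (by simp))
  have hcont : Continuous fun p : ℝ × Metric.sphere (0 : Eucl d) 1 =>
      fderiv ℝ φ (U p.1 p.2) ((U p.1 * A) p.2) := by
    have h1 : Continuous (fderiv ℝ φ) := hφ.continuous_fderiv one_ne_zero
    have h2 : Continuous fun p : ℝ × Metric.sphere (0 : Eucl d) 1 => U p.1 p.2 := by fun_prop
    have h3 : Continuous fun p : ℝ × Metric.sphere (0 : Eucl d) 1 => (U p.1 * A) p.2 := by
      change Continuous fun p : ℝ × Metric.sphere (0 : Eucl d) 1 => U p.1 (A p.2)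
      fun_prop
    exact (h1.comp h2).clm_apply h3
  obtain ⟨c, hc⟩ := (isCompact_Icc.prod isCompact_univ :
    IsCompact (Set.Icc (-1 : ℝ) 1 ×ˢ
      (Set.univ : Set (Metric.sphere (0 : Eucl d) 1)))).exists_bound_of_continuousOn
        hcont.continuousOn
  have hder := (hasDerivAt_integral_of_dominated_loc_of_deriv_le (μ := unifSphere d) (x₀ := (0 : ℝ))
    (F := fun t ζ => φ (U t ζ)) (F' := fun t ζ => fderiv ℝ φ (U t ζ) ((U t * A) ζ))
    (bound := fun _ => c) (s := Set.Icc (-1) 1) (Icc_mem_nhds (by norm_num) (by norm_num))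
    (Filter.Eventually.of_forall fun t =>
      (hφ.continuous.comp ((U t).continuous.comp continuous_subtype_val)).aestronglyMeasurable)
    (integrable_unifSphere hd (hφ.continuous.comp ((U 0).continuous.comp continuous_subtype_val)))
    (hcont.comp (by fun_prop :
      Continuous fun ζ : Metric.sphere (0 : Eucl d) 1 => ((0 : ℝ), ζ))).aestronglyMeasurable
    (Filter.Eventually.of_forall fun ζ t ht => hc (t, ζ) ⟨ht, Set.mem_univ _⟩)
    (integrable_const _)
    (Filter.Eventually.of_forall fun ζ t _ => hD t ζ)).2
  simp only [hconst] at hder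
  have h0 := hder.unique (hasDerivAt_const _ _)
  have hU0 : U 0 = 1 := (congrArg NormedSpace.exp (zero_smul ℝ A)).trans NormedSpace.exp_zero
  simpa [hU0] using h0


/-- The infinitesimal rotation in the plane of `u` and `w`. -/
noncomputable def planeRotation {d : ℕ} (u w : Eucl d) : Eucl d →L[ℝ] Eucl d :=
  (innerSL ℝ u).smulRight w - (innerSL ℝ w).smulRight u

theorem planeRotation_apply {d : ℕ} (u w z : Eucl d) :
    planeRotation u w z = ⟪u, z⟫ • w - ⟪w, z⟫ • u := by
  simp [planeRotation]

theorem planeRotation_mem_skewAdjoint {d : ℕ} (u w : Eucl d) :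
    planeRotation u w ∈ skewAdjoint (Eucl d →L[ℝ] Eucl d) := by
  rw [skewAdjoint.mem_iff, ContinuousLinearMap.star_eq_adjoint, eq_comm,
    ContinuousLinearMap.eq_adjoint_iff]
  intro y z
  simp only [neg_apply, planeRotation_apply, inner_neg_left, inner_sub_left,
    inner_sub_right, inner_smul_left, inner_smul_right, RCLike.conj_to_real]
  rw [real_inner_comm u y, real_inner_comm w y]
  ring

/-- Integration by parts on the sphere. It follows from infinitesimal rotation invariance, applied
to `φ` times the coordinate `⟪w, ·⟫` and the rotation in the plane of `u` and `w`, by summation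
over an orthonormal basis of vectors `w`. -/
theorem natCast_mul_integral_mul_inner_unifSphere {d : ℕ} (hd : 1 ≤ d) {φ : Eucl d → ℝ}
    (hφ : ContDiff ℝ 1 φ) (u : Eucl d) :
    (d : ℝ) * ∫ ζ, φ ζ * ⟪u, (ζ : Eucl d)⟫ ∂unifSphere d =
      ∫ ζ, (fderiv ℝ φ ζ u + ⟪u, (ζ : Eucl d)⟫ * (φ ζ - fderiv ℝ φ ζ ζ)) ∂unifSphere d := by
  let e := EuclideanSpace.basisFun (Fin d) ℝ
  have hφc := hφ.continuous
  have hφ' : Continuous (fderiv ℝ φ) := hφ.continuous_fderiv one_ne_zero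
  have h1 : ∀ i, ∫ ζ, (⟪e i, (ζ : Eucl d)⟫ * (fderiv ℝ φ ζ (planeRotation u (e i) ζ)) +
      φ ζ * ⟪e i, planeRotation u (e i) ζ⟫) ∂unifSphere d = 0 := by
    intro i
    have hψ : ContDiff ℝ 1 fun z : Eucl d => φ z * ⟪e i, z⟫ :=
      hφ.mul (innerSL ℝ (e i)).contDiff
    rw [← integral_fderiv_skew_unifSphere hd _ (planeRotation_mem_skewAdjoint u (e i)) hψ]
    refine integral_congr_ae (Filter.Eventually.of_forall fun ζ => ?_)
    have hf := ((hφ.differentiable one_ne_zero) (ζ : Eucl d)).hasFDerivAt.mul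
      (innerSL ℝ (e i)).hasFDerivAt
    have := hf.fderiv
    simp only [innerSL_apply_apply] at this
    simp only
    erw [this]
    simp
    ring
  have h2 : ∑ i, ∫ ζ, (⟪e i, (ζ : Eucl d)⟫ * (fderiv ℝ φ ζ (planeRotation u (e i) ζ)) +
      φ ζ * ⟪e i, planeRotation u (e i) ζ⟫) ∂unifSphere d = 0 :=
    Finset.sum_eq_zero fun i _ => h1 i
  rw [← integral_finsetSum] at h2
  swap
  · intro i _
    refine integrable_unifSphere hd ?_
    fun_prop
  rw [← integral_const_mul, ← sub_eq_zero, ← integral_sub, ← h2]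
  · refine integral_congr_ae (Filter.Eventually.of_forall fun ζ => ?_)
    have hz : ‖(ζ : Eucl d)‖ = 1 := by simp
    have s1 : ∑ i, ⟪e i, (ζ : Eucl d)⟫ • e i = ζ := e.sum_repr' _
    have s2 : ∑ i, ⟪e i, (ζ : Eucl d)⟫ * ⟪e i, (ζ : Eucl d)⟫ = 1 := by
      have := e.sum_inner_mul_inner (ζ : Eucl d) ζ
      simp only [real_inner_comm, real_inner_self_eq_norm_sq, hz] at this ⊢
      simpa using this
    have s3 : ∑ i, ⟪e i, (ζ : Eucl d)⟫ * ⟪u, e i⟫ = ⟪u, (ζ : Eucl d)⟫ := by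
      have := e.sum_inner_mul_inner u (ζ : Eucl d)
      rw [← this]
      exact Finset.sum_congr rfl fun i _ => mul_comm _ _
    have s4 : ∑ i, ⟪e i, (ζ : Eucl d)⟫ * fderiv ℝ φ ζ (e i) = fderiv ℝ φ ζ ζ := by
      conv_rhs => rw [← congrArg (fderiv ℝ φ ζ) s1]
      simp
    have s5 : ∀ i, ⟪e i, e i⟫ = 1 := fun i => by
      rw [real_inner_self_eq_norm_sq, e.norm_eq_one]; norm_num
    have : ∀ i, ⟪e i, (ζ : Eucl d)⟫ * (fderiv ℝ φ ζ (planeRotation u (e i) ζ)) +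
        φ ζ * ⟪e i, planeRotation u (e i) ζ⟫ =
        ⟪u, (ζ : Eucl d)⟫ * (⟪e i, (ζ : Eucl d)⟫ * fderiv ℝ φ ζ (e i))
        - fderiv ℝ φ ζ u * (⟪e i, (ζ : Eucl d)⟫ * ⟪e i, (ζ : Eucl d)⟫)
        + φ ζ * ⟪u, (ζ : Eucl d)⟫ - φ ζ * (⟪e i, (ζ : Eucl d)⟫ * ⟪u, e i⟫) := by
      intro i
      simp only [planeRotation_apply, map_sub, map_smul, inner_sub_right, inner_smul_right, s5,
        smul_eq_mul]
      rw [real_inner_comm u (e i)]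
      ring
    simp only [this, Finset.sum_add_distrib, Finset.sum_sub_distrib, ← Finset.mul_sum, s2, s3, s4]
    simp
    ring
  · refine integrable_unifSphere hd ?_
    fun_prop
  · refine integrable_unifSphere hd ?_
    fun_prop

/-! ### Taylor expansion along lines -/

theorem norm_sub_taylor_le_rpow {G : Type*} [NormedAddCommGroup G] [NormedSpace ℝ G] {L γ : ℝ}
    (hγ : 0 ≤ γ) (n : ℕ) {p : ℝ → G} (hp : ContDiff ℝ n p)
    (hL : ∀ s, ‖iteratedDeriv n p s - iteratedDeriv n p 0‖ ≤ L * |s| ^ γ) (t : ℝ) :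
    ‖p t - ∑ j ∈ Finset.range (n + 1), (t ^ j / (j.factorial : ℝ)) • iteratedDeriv j p 0‖ ≤
      L * |t| ^ ((n : ℝ) + γ) := by
  have hL0 : 0 ≤ L := by simpa using (norm_nonneg _).trans (hL 1)
  induction n generalizing p t with
  | zero => simpa using hL t
  | succ n ih =>
    have hp' : ContDiff ℝ n (deriv p) := by
      have : ContDiff ℝ ((n : ℕ∞) + 1) p := by exact_mod_cast hp
      exact (contDiff_succ_iff_deriv.1 this).2.2
    have hpd : Differentiable ℝ p := hp.differentiable (by simp)
    have ih' := ih hp' (by simpa only [iteratedDeriv_succ'] using hL)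
    have hder : ∀ s, HasDerivAt
        (fun s => p s - ∑ j ∈ Finset.range (n + 1 + 1),
          (s ^ j / (j.factorial : ℝ)) • iteratedDeriv j p 0)
        (deriv p s - ∑ j ∈ Finset.range (n + 1),
          (s ^ j / (j.factorial : ℝ)) • iteratedDeriv j (deriv p) 0) s := by
      intro s
      refine (hpd s).hasDerivAt.sub ?_
      simp only [Finset.sum_range_succ' _ (n + 1)]
      have h1 : HasDerivAt (fun s : ℝ => ∑ j ∈ Finset.range (n + 1),
          (s ^ (j + 1) / ((j + 1).factorial : ℝ)) • iteratedDeriv (j + 1) p 0)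
          (∑ j ∈ Finset.range (n + 1),
            (s ^ j / (j.factorial : ℝ)) • iteratedDeriv j (deriv p) 0) s := by
        refine HasDerivAt.fun_sum fun j _ => ?_
        rw [iteratedDeriv_succ']
        refine HasDerivAt.smul_const (((hasDerivAt_pow (j + 1) s).div_const _).congr_deriv ?_) _
        rw [Nat.factorial_succ]
        push_cast
        have := Nat.factorial_ne_zero j
        field_simp
      simpa using h1.add_const ((s ^ 0 / ((Nat.factorial 0 : ℕ) : ℝ)) • iteratedDeriv 0 p 0)
    have hmv := (convex_Icc (-|t|) |t|).norm_image_sub_le_of_norm_hasDerivWithin_le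
      (C := L * |t| ^ ((n : ℝ) + γ)) (fun s _ => (hder s).hasDerivWithinAt)
      (fun s hs => (ih' s).trans (mul_le_mul_of_nonneg_left
        (Real.rpow_le_rpow (abs_nonneg _) (abs_le.2 hs) (by positivity)) hL0))
      (show (0 : ℝ) ∈ Set.Icc (-|t|) |t| by simp) (show t ∈ Set.Icc (-|t|) |t| from
        ⟨neg_abs_le t, le_abs_self t⟩)
    have h0 : p 0 - ∑ j ∈ Finset.range (n + 1 + 1),
        ((0 : ℝ) ^ j / (j.factorial : ℝ)) • iteratedDeriv j p 0 = 0 := by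
      simp [Finset.sum_range_succ' _ (n + 1)]
    simp only [h0, sub_zero] at hmv
    refine hmv.trans (le_of_eq ?_)
    rw [Real.norm_eq_abs, mul_assoc]
    congr 1
    push_cast
    rw [show (n : ℝ) + 1 + γ = (n + γ) + 1 by ring,
      Real.rpow_add_one' (abs_nonneg _) (by positivity)]

theorem iteratedDeriv_comp_line {E G : Type*} [NormedAddCommGroup E] [NormedSpace ℝ E]
    [NormedAddCommGroup G] [NormedSpace ℝ G] {n : ℕ} {F : E → G} (hF : ContDiff ℝ n F)
    (x v : E) (s : ℝ) :
    iteratedDeriv n (fun s : ℝ => F (x + s • v)) s =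
      iteratedFDeriv ℝ n F (x + s • v) fun _ => v := by
  have hF' : ContDiff ℝ n fun z => F (x + z) := hF.comp (contDiff_const.add contDiff_id)
  have h := (ContinuousLinearMap.toSpanSingleton ℝ v).iteratedFDeriv_comp_right hF' s le_rfl
  rw [iteratedDeriv_eq_iteratedFDeriv]
  have h' : ((fun z => F (x + z)) ∘ (ContinuousLinearMap.toSpanSingleton ℝ v)) =
      fun s : ℝ => F (x + s • v) := by
    ext s
    simp
  rw [h'] at h
  rw [h, iteratedFDeriv_comp_add_left]
  simp

/-- Taylor expansion along a line, with a remainder controlled by the Hölder constant of the top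
derivative. -/
theorem exists_taylor_line {E G : Type*} [NormedAddCommGroup E] [NormedSpace ℝ E]
    [NormedAddCommGroup G] [NormedSpace ℝ G] {n : ℕ} {F : E → G} (hF : ContDiff ℝ n F)
    {L γ : ℝ} (hγ : 0 ≤ γ)
    (hL : ∀ x z, ‖iteratedFDeriv ℝ n F x - iteratedFDeriv ℝ n F z‖ ≤ L * ‖x - z‖ ^ γ)
    (x v : E) (hv : ‖v‖ = 1) :
    ∃ c : ℕ → G, c 0 = F x ∧ (1 ≤ n → c 1 = fderiv ℝ F x v) ∧
      ∀ s : ℝ, ‖F (x + s • v) - ∑ j ∈ Finset.range (n + 1), s ^ j • c j‖ ≤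
        L * |s| ^ ((n : ℝ) + γ) := by
  have hp : ContDiff ℝ n fun s : ℝ => F (x + s • v) := hF.comp (by fun_prop)
  refine ⟨fun j => ((j.factorial : ℝ)⁻¹) • iteratedDeriv j (fun s : ℝ => F (x + s • v)) 0, by simp,
    fun hn => ?_, fun s => ?_⟩
  · have := iteratedDeriv_comp_line (n := 1) (hF.of_le (by exact_mod_cast hn)) x v 0
    simp only [Nat.factorial_one, Nat.cast_one, inv_one, one_smul]
    rw [this]
    simp
  · have := norm_sub_taylor_le_rpow (L := L) hγ n hp ?_ s
    · simpa only [smul_smul, div_eq_mul_inv] using this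
    · intro s
      rw [iteratedDeriv_comp_line hF, iteratedDeriv_comp_line hF,
        ← sub_apply]
      refine (ContinuousMultilinearMap.le_opNorm _ _).trans ?_
      simp only [hv, Finset.prod_const_one, mul_one]
      refine (hL _ _).trans (le_of_eq ?_)
      simp [norm_smul, hv]

theorem norm_iteratedFDeriv_fderiv_sub {E G : Type*} [NormedAddCommGroup E] [NormedSpace ℝ E]
    [NormedAddCommGroup G] [NormedSpace ℝ G] (n : ℕ) (f : E → G) (y z : E) :
    ‖iteratedFDeriv ℝ n (fderiv ℝ f) y - iteratedFDeriv ℝ n (fderiv ℝ f) z‖ =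
      ‖iteratedFDeriv ℝ (n + 1) f y - iteratedFDeriv ℝ (n + 1) f z‖ := by
  have e : ∀ y, iteratedFDeriv ℝ (n + 1) f y =
      (continuousMultilinearCurryRightEquiv' ℝ n E G).symm (iteratedFDeriv ℝ n (fderiv ℝ f) y) :=
    fun y => iteratedFDeriv_succ_eq_comp_right
  rw [e, e, ← dist_eq_norm, ← dist_eq_norm]
  exact (LinearIsometryEquiv.dist_map _ _ _).symm

theorem HolderSmooth.nonneg {d : ℕ} (hd : 1 ≤ d) {β L : ℝ} {f : Eucl d → ℝ}
    (hf : HolderSmooth β L f) : 0 ≤ L := by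
  have := (norm_nonneg _).trans (hf.holder (EuclideanSpace.single ⟨0, hd⟩ 1) 0)
  simpa using this

/-- The integrand produced by integration by parts on the sphere, as a function of the signed
radius `s`: its spherical mean is `d` times that of `f (x + s ζ) ⟪u, ζ⟫`. -/
noncomputable def sphericalPart {d : ℕ} (f : Eucl d → ℝ) (x u ζ : Eucl d) (s : ℝ) : ℝ :=
  s * fderiv ℝ f (x + s • ζ) (u - ⟪u, ζ⟫ • ζ) + ⟪u, ζ⟫ * f (x + s • ζ)

/-- The Taylor remainder of `sphericalPart` does not involve the dimension, and the derivative at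
`0` is the full directional derivative of `f` whatever the direction `ζ`. -/
theorem exists_taylor_sphericalPart {d : ℕ} {β L : ℝ} (hβ : 2 ≤ β) {f : Eucl d → ℝ}
    (hd : 1 ≤ d) (hf : HolderSmooth β L f) (x u ζ : Eucl d) (hu : ‖u‖ = 1) (hζ : ‖ζ‖ = 1) :
    ∃ a : ℕ → ℝ, a 1 = fderiv ℝ f x u ∧
      ∀ s, |sphericalPart f x u ζ s - ∑ j ∈ Finset.range (⌊β⌋₊ + 1), s ^ j * a j| ≤
        2 * L * |s| ^ β := by
  have hL := hf.nonneg hd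
  obtain ⟨n, hn⟩ : ∃ n, ⌊β⌋₊ = n + 1 :=
    ⟨⌊β⌋₊ - 1, by have : 2 ≤ ⌊β⌋₊ := Nat.le_floor (by exact_mod_cast hβ); omega⟩
  have hγ : 0 ≤ β - ⌊β⌋₊ := sub_nonneg.2 (Nat.floor_le (by linarith))
  obtain ⟨c, -, hc1, hc⟩ := exists_taylor_line hf.contDiff hγ hf.holder x ζ hζ
  have hf' : ContDiff ℝ n (fderiv ℝ f) := by
    have := hf.contDiff
    rw [hn] at this
    exact this.fderiv_right (by norm_cast)
  obtain ⟨e, he0, -, he⟩ := exists_taylor_line (L := L) hf' hγ (fun y z => by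
    refine le_trans (le_of_eq ?_) (hf.holder y z)
    rw [hn, norm_iteratedFDeriv_fderiv_sub]) x ζ hζ
  have hb : β = ((n + 1 : ℕ) : ℝ) + (β - ⌊β⌋₊) := by rw [hn]; ring
  generalize β - ⌊β⌋₊ = γ at hγ hc he hb
  rw [hn] at hc hc1
  have hc1 := hc1 (by omega)
  -- `w` is the projection of `u` on the tangent space, whence `‖w‖ ≤ 1`
  set w := u - ⟪u, ζ⟫ • ζ with hw
  have hin : |⟪u, ζ⟫| ≤ 1 := by simpa [hu, hζ] using abs_real_inner_le_norm u ζ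
  have hw1 : ‖w‖ ≤ 1 := by
    have h2 : ‖w‖ ^ 2 ≤ 1 := by
      rw [hw, norm_sub_sq_real, norm_smul, inner_smul_right, hu, hζ, Real.norm_eq_abs, mul_one,
        sq_abs]
      nlinarith [sq_nonneg ⟪u, ζ⟫]
    nlinarith [norm_nonneg w]
  refine ⟨fun j => ⟪u, ζ⟫ * c j + if j = 0 then 0 else e (j - 1) w, ?_, fun s => ?_⟩
  · simp only [hc1, one_ne_zero, if_false, Nat.sub_self, he0, hw, map_sub, map_smul, smul_eq_mul]
    ring
  · have hsum : ∑ j ∈ Finset.range (⌊β⌋₊ + 1),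
        s ^ j * (⟪u, ζ⟫ * c j + if j = 0 then 0 else e (j - 1) w) =
        ⟪u, ζ⟫ * ∑ j ∈ Finset.range (n + 1 + 1), s ^ j • c j +
          s * (∑ j ∈ Finset.range (n + 1), s ^ j • e j) w := by
      simp only [mul_add, Finset.sum_add_distrib, hn]
      congr 1
      · rw [Finset.mul_sum]
        exact Finset.sum_congr rfl fun j _ => by rw [smul_eq_mul]; ring
      · rw [Finset.sum_range_succ']
        simp only [Nat.add_eq_zero_iff, one_ne_zero, and_false, if_false, if_true, mul_zero,
          add_zero, Nat.add_sub_cancel, sum_apply, Finset.mul_sum,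
          smul_apply, smul_eq_mul]
        exact Finset.sum_congr rfl fun j _ => by ring
    rw [hsum, sphericalPart]
    have hsplit : s * fderiv ℝ f (x + s • ζ) w + ⟪u, ζ⟫ * f (x + s • ζ) -
        (⟪u, ζ⟫ * ∑ j ∈ Finset.range (n + 1 + 1), s ^ j • c j +
          s * (∑ j ∈ Finset.range (n + 1), s ^ j • e j) w) =
        s * (fderiv ℝ f (x + s • ζ) - ∑ j ∈ Finset.range (n + 1), s ^ j • e j) w +
        ⟪u, ζ⟫ * (f (x + s • ζ) - ∑ j ∈ Finset.range (n + 1 + 1), s ^ j • c j) := by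
      rw [sub_apply]
      ring
    rw [hsplit]
    have b1 : |⟪u, ζ⟫ * (f (x + s • ζ) - ∑ j ∈ Finset.range (n + 1 + 1), s ^ j • c j)| ≤
        L * |s| ^ β := by
      rw [abs_mul]
      have := hc s
      rw [Real.norm_eq_abs, ← hb] at this
      calc _ ≤ 1 * (L * |s| ^ β) := mul_le_mul hin this (abs_nonneg _) zero_le_one
        _ = _ := one_mul _
    have b2 : |s * (fderiv ℝ f (x + s • ζ) - ∑ j ∈ Finset.range (n + 1), s ^ j • e j) w| ≤
        L * |s| ^ β := by
      have h1 := (ContinuousLinearMap.le_opNorm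
        (fderiv ℝ f (x + s • ζ) - ∑ j ∈ Finset.range (n + 1), s ^ j • e j) w).trans
        (mul_le_mul (he s) hw1 (norm_nonneg _) (by positivity))
      rw [abs_mul]
      refine (mul_le_mul_of_nonneg_left h1 (abs_nonneg s)).trans (le_of_eq ?_)
      rw [mul_one, hb]
      push_cast
      rw [show (n : ℝ) + 1 + γ = (n + γ) + 1 by ring,
        Real.rpow_add_one' (abs_nonneg _) (by positivity)]
      ring
    exact (abs_add_le _ _).trans (by linarith)

/-! ### Smoothing kernels -/

theorem isProbabilityMeasure_unifInterval : IsProbabilityMeasure unifInterval :=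
  ProbabilityTheory.cond_isProbabilityMeasure_of_finite (by simp) (by simp)

theorem ae_unifInterval_mem_Icc : ∀ᵐ r ∂unifInterval, r ∈ Set.Icc (-1 : ℝ) 1 :=
  ProbabilityTheory.ae_cond_mem measurableSet_Icc

theorem IsSmoothingKernel.integrable {β : ℝ} {K : ℝ → ℝ} (hK : IsSmoothingKernel β K) :
    Integrable K unifInterval :=
  have := isProbabilityMeasure_unifInterval
  hK.sq_integrable.integrable one_le_two

theorem IsSmoothingKernel.integrable_mul {β : ℝ} {K : ℝ → ℝ} (hK : IsSmoothingKernel β K)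
    {c : ℝ → ℝ} (hc : Continuous c) : Integrable (fun r => c r * K r) unifInterval := by
  obtain ⟨B, hB⟩ := isCompact_Icc.exists_bound_of_continuousOn (s := Set.Icc (-1 : ℝ) 1)
    hc.continuousOn
  exact hK.integrable.bdd_mul hc.aestronglyMeasurable
    (ae_unifInterval_mem_Icc.mono fun r hr => hB r hr)

/-- Integration against a smoothing kernel of an odd difference picks the derivative at `0`: the
moment conditions remove the other odd terms of the expansion, and the even ones cancel. -/
theorem IsSmoothingKernel.abs_integral_sub_le {β : ℝ} {K : ℝ → ℝ} (hK : IsSmoothingKernel β K)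
    (hβ : 2 ≤ β) {h M : ℝ} (hh : 0 < h) {H : ℝ → ℝ} (hH : Continuous H) {a : ℕ → ℝ}
    (ha : ∀ s, |H s - ∑ j ∈ Finset.range (⌊β⌋₊ + 1), s ^ j * a j| ≤ M * |s| ^ β) :
    |∫ r, (H (h * r) - H (-(h * r))) * K r ∂unifInterval - 2 * h * a 1| ≤
      2 * M * h ^ β * ∫ r, |r| ^ β * |K r| ∂unifInterval := by
  have hl : 2 ≤ ⌊β⌋₊ := Nat.le_floor (by exact_mod_cast hβ)
  let q : ℝ → ℝ := fun r => ∑ j ∈ Finset.range (⌊β⌋₊ + 1),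
    (h ^ j * (1 - (-1) ^ j) * a j) * (r ^ j * K r)
  have hmom : ∫ r, q r ∂unifInterval = 2 * h * a 1 := by
    have hi : ∀ j, Integrable (fun r => r ^ j * K r) unifInterval := fun j =>
      hK.integrable_mul (continuous_pow j)
    rw [integral_finsetSum _ fun j _ => (hi j).const_mul _, Finset.sum_eq_single 1]
    · rw [integral_const_mul]
      simp only [pow_one, hK.moment_one]
      ring
    · intro j hj hj1
      rw [integral_const_mul]
      rcases Nat.even_or_odd j with he | ho
      · simp [he.neg_one_pow]
      -- an odd term other than the linear one occurs only for `β > 2`, where its moment vanishes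
      · have hj3 : 3 ≤ j := by
          obtain ⟨k, rfl⟩ := ho
          omega
        have hjl : j ≤ ⌊β⌋₊ := by
          have := Finset.mem_range.1 hj
          omega
        have hjβ : (j : ℝ) ≤ β := (Nat.le_floor_iff (by linarith)).1 hjl
        have : (3 : ℝ) ≤ j := by exact_mod_cast hj3
        rw [hK.higher_moments (by linarith) j (by omega) hjl, mul_zero]
    · intro h1
      exact absurd (Finset.mem_range.2 (by omega)) h1
  have hqi : Integrable q unifInterval :=
    integrable_finsetSum _ fun j _ => (hK.integrable_mul (continuous_pow j)).const_mul _
  have hHi : Integrable (fun r => (H (h * r) - H (-(h * r))) * K r) unifInterval :=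
    hK.integrable_mul (by fun_prop)
  rw [← hmom, ← integral_sub hHi hqi, ← integral_const_mul, ← Real.norm_eq_abs]
  refine norm_integral_le_of_norm_le (hK.integrable_rpow.const_mul _)
    (Filter.Eventually.of_forall fun r => ?_)
  have hq : q r = (∑ j ∈ Finset.range (⌊β⌋₊ + 1), (h * r) ^ j * a j -
      ∑ j ∈ Finset.range (⌊β⌋₊ + 1), (-(h * r)) ^ j * a j) * K r := by
    simp only [q, ← Finset.sum_sub_distrib, Finset.sum_mul]
    refine Finset.sum_congr rfl fun j _ => ?_
    rw [neg_pow (h * r), mul_pow]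
    ring
  rw [hq, ← sub_mul, norm_mul, Real.norm_eq_abs, Real.norm_eq_abs]
  have e1 := ha (h * r)
  have e2 := ha (-(h * r))
  rw [abs_neg] at e2
  have e3 : |h * r| ^ β = h ^ β * |r| ^ β := by
    rw [abs_mul, abs_of_pos hh, Real.mul_rpow hh.le (abs_nonneg _)]
  rw [e3] at e1 e2
  calc _ ≤ (M * (h ^ β * |r| ^ β) + M * (h ^ β * |r| ^ β)) * |K r| := by
        refine mul_le_mul_of_nonneg_right ?_ (abs_nonneg _)
        refine le_trans (le_of_eq ?_) ((abs_sub _ _).trans (add_le_add e1 e2))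
        congr 1
        ring
    _ = _ := by ring

/-! ### The averaged noise-free estimator -/

/-- Integration by parts on the sphere for `z ↦ f (x + s z)`. -/
theorem natCast_mul_integral_mul_inner_eq_sphericalPart {d : ℕ} (hd : 1 ≤ d) {f : Eucl d → ℝ}
    (hf : ContDiff ℝ 1 f) (x u : Eucl d) (s : ℝ) :
    (d : ℝ) * ∫ ζ, f (x + s • (ζ : Eucl d)) * ⟪u, (ζ : Eucl d)⟫ ∂unifSphere d =
      ∫ ζ, sphericalPart f x u (ζ : Eucl d) s ∂unifSphere d := by
  have hφ : ContDiff ℝ 1 fun z : Eucl d => f (x + s • z) := hf.comp (by fun_prop)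
  rw [natCast_mul_integral_mul_inner_unifSphere hd hφ u]
  refine integral_congr_ae (Filter.Eventually.of_forall fun ζ => ?_)
  have hder : fderiv ℝ (fun z : Eucl d => f (x + s • z)) ζ =
      s • fderiv ℝ f (x + s • (ζ : Eucl d)) := by
    have h1 := ((hf.differentiable one_ne_zero) (x + s • (ζ : Eucl d))).hasFDerivAt
    have h2 : HasFDerivAt (fun z : Eucl d => x + s • z) (s • ContinuousLinearMap.id ℝ (Eucl d))
        (ζ : Eucl d) := ((hasFDerivAt_id _).const_smul s).const_add x
    refine (h1.comp (ζ : Eucl d) h2).fderiv.trans ?_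
    ext v
    simp
  simp only [hder, sphericalPart, smul_apply, smul_eq_mul, map_sub, map_smul]
  ring

/-- The joint law of the random scalar and the random direction. -/
noncomputable def drawLaw (d : ℕ) : Measure (ℝ × Metric.sphere (0 : Eucl d) 1) :=
  unifInterval.prod (unifSphere d)

theorem ae_drawLaw_fst_mem_Icc {d : ℕ} (hd : 1 ≤ d) :
    ∀ᵐ ρ ∂drawLaw d, ρ.1 ∈ Set.Icc (-1 : ℝ) 1 := by
  have := isProbabilityMeasure_unifSphere hd
  have := isProbabilityMeasure_unifInterval
  exact Measure.quasiMeasurePreserving_fst.ae ae_unifInterval_mem_Icc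

theorem integrable_kernel_smul_drawLaw {d : ℕ} (hd : 1 ≤ d) {G : Type*} [NormedAddCommGroup G]
    [NormedSpace ℝ G] {K : ℝ → ℝ} (hK : Integrable K unifInterval)
    {c : ℝ × Metric.sphere (0 : Eucl d) 1 → G} (hc : Continuous c) :
    Integrable (fun ρ => K ρ.1 • c ρ) (drawLaw d) := by
  have := isProbabilityMeasure_unifSphere hd
  have := isProbabilityMeasure_unifInterval
  obtain ⟨B, hB⟩ := ((isCompact_Icc (a := (-1 : ℝ)) (b := 1)).prod
    (isCompact_univ (X := Metric.sphere (0 : Eucl d) 1))).exists_bound_of_continuousOn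
      hc.continuousOn
  have hKi : Integrable (fun ρ : ℝ × Metric.sphere (0 : Eucl d) 1 => K ρ.1) (drawLaw d) :=
    hK.comp_fst _
  refine (hKi.norm.const_mul B).mono' (hKi.aestronglyMeasurable.smul hc.aestronglyMeasurable)
    ((ae_drawLaw_fst_mem_Icc hd).mono fun ρ hρ => ?_)
  rw [norm_smul, mul_comm]
  exact mul_le_mul_of_nonneg_right (hB ρ ⟨hρ, Set.mem_univ _⟩) (norm_nonneg _)

/-- The noise-free estimator at `x`, as a function of the drawn scalar and direction. -/
noncomputable def estimatorAt {d : ℕ} (K : ℝ → ℝ) (h : ℝ) (f : Eucl d → ℝ) (x : Eucl d)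
    (ρ : ℝ × Metric.sphere (0 : Eucl d) 1) : Eucl d :=
  twoPointEstimator K h ρ.1 ρ.2 (f (queryPoint 1 h ρ.1 ρ.2 x)) (f (queryPoint (-1) h ρ.1 ρ.2 x))

theorem estimatorAt_eq_kernel_smul {d : ℕ} (K : ℝ → ℝ) (h : ℝ) (f : Eucl d → ℝ) (x : Eucl d)
    (ρ : ℝ × Metric.sphere (0 : Eucl d) 1) :
    estimatorAt K h f x ρ = K ρ.1 • (((d : ℝ) / (2 * h) * (f (x + (h * ρ.1) • (ρ.2 : Eucl d)) -
      f (x + (-(h * ρ.1)) • (ρ.2 : Eucl d)))) • (ρ.2 : Eucl d)) := by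
  simp only [estimatorAt, twoPointEstimator, queryPoint, one_mul, neg_mul, smul_smul]
  congr 1
  ring

theorem integrable_estimatorAt {d : ℕ} (hd : 1 ≤ d) {K : ℝ → ℝ} (hK : Integrable K unifInterval)
    (h : ℝ) {f : Eucl d → ℝ} (hf : Continuous f) (x : Eucl d) :
    Integrable (estimatorAt K h f x) (drawLaw d) := by
  simp only [funext (estimatorAt_eq_kernel_smul K h f x)]
  exact integrable_kernel_smul_drawLaw hd hK (by fun_prop)

/-- The bias of the noise-free estimator, with a constant that does not depend on the dimension. -/
theorem norm_integral_estimatorAt_sub_gradient_le {d : ℕ} (hd : 1 ≤ d) {β L h : ℝ} (hβ : 2 ≤ β)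
    {K : ℝ → ℝ} (hK : IsSmoothingKernel β K) (hh : 0 < h) {f : Eucl d → ℝ}
    (hf : HolderSmooth β L f) (x : Eucl d) :
    ‖∫ ρ, estimatorAt K h f x ρ ∂drawLaw d - gradient f x‖ ≤
      2 * L * h ^ (β - 1) * ∫ r, |r| ^ β * |K r| ∂unifInterval := by
  have := isProbabilityMeasure_unifSphere hd
  have := isProbabilityMeasure_unifInterval
  have hL := hf.nonneg hd
  have hf1 : ContDiff ℝ 1 f := hf.contDiff.of_le (by
    have : 1 ≤ ⌊β⌋₊ := Nat.le_floor (by norm_num; linarith)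
    exact_mod_cast this)
  have hfc := hf1.continuous
  have hfd : Continuous (fderiv ℝ f) := hf1.continuous_fderiv one_ne_zero
  have hκ : 0 ≤ ∫ r, |r| ^ β * |K r| ∂unifInterval := integral_nonneg fun r => by positivity
  set C := 2 * L * h ^ (β - 1) * ∫ r, |r| ^ β * |K r| ∂unifInterval with hC
  set V := ∫ ρ, estimatorAt K h f x ρ ∂drawLaw d with hV
  -- it is enough to test against unit vectors
  suffices H : ∀ u : Eucl d, ‖u‖ = 1 → |⟪u, V⟫ - fderiv ℝ f x u| ≤ C by
    rcases eq_or_ne (V - gradient f x) 0 with h0 | h0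
    · rw [h0, norm_zero]
      positivity
    · have hn : ‖V - gradient f x‖ ≠ 0 := norm_ne_zero_iff.2 h0
      have h1 := H (‖V - gradient f x‖⁻¹ • (V - gradient f x)) (norm_smul_inv_norm h0)
      have h2 : ∀ u, fderiv ℝ f x u = ⟪u, gradient f x⟫ := fun u => by
        rw [real_inner_comm, gradient, InnerProductSpace.toDual_symm_apply]
      rw [h2, ← inner_sub_right, real_inner_smul_left, real_inner_self_eq_norm_sq, pow_two,
        inv_mul_cancel_left₀ hn] at h1
      exact (le_abs_self _).trans h1
  intro u hu
  let c : ℝ × Metric.sphere (0 : Eucl d) 1 → ℝ := fun ρ => (2 * h)⁻¹ *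
    (sphericalPart f x u ρ.2 (h * ρ.1) - sphericalPart f x u ρ.2 (-(h * ρ.1)))
  have hSc : Continuous fun p : ℝ × Metric.sphere (0 : Eucl d) 1 =>
      sphericalPart f x u p.2 p.1 := by
    unfold sphericalPart
    have h1 : Continuous fun p : ℝ × Metric.sphere (0 : Eucl d) 1 =>
      fderiv ℝ f (x + p.1 • (p.2 : Eucl d)) := hfd.comp (by fun_prop)
    exact (continuous_fst.mul (h1.clm_apply (by fun_prop))).add (by fun_prop)
  have hcc : Continuous c := by
    have h1 : Continuous fun p : ℝ × Metric.sphere (0 : Eucl d) 1 =>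
        sphericalPart f x u p.2 (h * p.1) :=
      hSc.comp (by fun_prop : Continuous fun p : ℝ × Metric.sphere (0 : Eucl d) 1 =>
        (h * p.1, p.2))
    have h2 : Continuous fun p : ℝ × Metric.sphere (0 : Eucl d) 1 =>
        sphericalPart f x u p.2 (-(h * p.1)) :=
      hSc.comp (by fun_prop : Continuous fun p : ℝ × Metric.sphere (0 : Eucl d) 1 =>
        (-(h * p.1), p.2))
    exact continuous_const.mul (h1.sub h2)
  have hci := integrable_kernel_smul_drawLaw hd hK.integrable hcc
  have hVu : ⟪u, V⟫ = ∫ ρ, K ρ.1 • c ρ ∂drawLaw d := by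
    rw [hV, ← integral_inner (integrable_estimatorAt hd hK.integrable h hfc x)]
    have hi : Integrable (fun ρ => ⟪u, estimatorAt K h f x ρ⟫) (drawLaw d) :=
      (integrable_estimatorAt hd hK.integrable h hfc x).const_inner u
    unfold drawLaw at hi hci ⊢
    rw [integral_prod _ hi, integral_prod _ hci]
    refine integral_congr_ae (Filter.Eventually.of_forall fun r => ?_)
    simp only [estimatorAt_eq_kernel_smul, real_inner_smul_right, smul_eq_mul, c]
    rw [integral_const_mul, integral_const_mul, integral_const_mul]
    congr 1
    have hS : ∀ s, Integrable (fun ζ : Metric.sphere (0 : Eucl d) 1 =>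
        sphericalPart f x u (ζ : Eucl d) s) (unifSphere d) := fun s =>
      integrable_unifSphere hd (hSc.comp (by fun_prop :
        Continuous fun ζ : Metric.sphere (0 : Eucl d) 1 => (s, ζ)))
    have hI : ∀ s : ℝ, Integrable (fun ζ : Metric.sphere (0 : Eucl d) 1 =>
        f (x + s • (ζ : Eucl d)) * ⟪u, (ζ : Eucl d)⟫) (unifSphere d) := fun s =>
      integrable_unifSphere hd (by fun_prop)
    rw [integral_sub (hS _) (hS _), ← natCast_mul_integral_mul_inner_eq_sphericalPart hd hf1,
      ← natCast_mul_integral_mul_inner_eq_sphericalPart hd hf1, ← mul_sub,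
      ← integral_sub (hI _) (hI _), ← integral_const_mul, ← integral_const_mul]
    refine integral_congr_ae (Filter.Eventually.of_forall fun ζ => ?_)
    simp only
    ring
  have hsymm : ∫ ρ, K ρ.1 • c ρ ∂drawLaw d =
      ∫ ζ, ∫ r, K r • c (r, ζ) ∂unifInterval ∂unifSphere d := by
    unfold drawLaw at hci ⊢
    exact integral_prod_symm _ hci
  have hii : Integrable (fun ζ => ∫ r, K r • c (r, ζ) ∂unifInterval) (unifSphere d) := by
    unfold drawLaw at hci
    exact hci.integral_prod_right
  have hconst : fderiv ℝ f x u = ∫ _ζ, fderiv ℝ f x u ∂unifSphere d := by simp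
  rw [hVu, hsymm, hconst, ← integral_sub hii (integrable_const _), ← Real.norm_eq_abs]
  refine (norm_integral_le_of_norm_le_const (C := C)
    (Filter.Eventually.of_forall fun ζ => ?_)).trans (by simp)
  have hζ : ‖(ζ : Eucl d)‖ = 1 := by simp
  obtain ⟨a, ha1, ha⟩ := exists_taylor_sphericalPart hβ hd hf x u ζ hu hζ
  have hcont : Continuous fun s => sphericalPart f x u (ζ : Eucl d) s :=
    hSc.comp (by fun_prop : Continuous fun s : ℝ => (s, ζ))
  have hb := hK.abs_integral_sub_le hβ hh hcont ha
  have heq : ∫ r, K r • c (r, ζ) ∂unifInterval = (2 * h)⁻¹ *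
      ∫ r, (sphericalPart f x u ζ (h * r) - sphericalPart f x u ζ (-(h * r))) * K r
        ∂unifInterval := by
    rw [← integral_const_mul]
    refine integral_congr_ae (Filter.Eventually.of_forall fun r => ?_)
    simp only [c, smul_eq_mul]
    ring
  rw [heq, Real.norm_eq_abs]
  rw [ha1] at hb
  have h3 : ∀ I D : ℝ, (2 * h)⁻¹ * I - D = (2 * h)⁻¹ * (I - 2 * h * D) := fun I D => by
    field_simp
  rw [h3, abs_mul, abs_of_pos (by positivity : 0 < (2 * h)⁻¹)]
  refine (mul_le_mul_of_nonneg_left hb (by positivity)).trans (le_of_eq ?_)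
  rw [hC, Real.rpow_sub_one hh.ne']
  field_simp

/-! ### Bounds on conditional expectations -/

section CondLExp

variable {Ω : Type*} {F m0 : MeasurableSpace Ω} {μ : Measure[m0] Ω}

theorem condLExp_le_of_forall_setLIntegral_le [IsFiniteMeasure μ] (hF : F ≤ m0) {X Y : Ω → ℝ≥0∞}
    (hY : Measurable[F] Y)
    (h : ∀ s, MeasurableSet[F] s → ∫⁻ ω in s, X ω ∂μ ≤ ∫⁻ ω in s, Y ω ∂μ) :
    μ⁻[X|F] ≤ᵐ[μ] Y := by
  refine ae_le_of_ae_le_trim (hm := hF) ?_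
  refine ae_le_of_forall_setLIntegral_le_of_sigmaFinite (μ := μ.trim hF)
    (measurable_condLExp _ _ _) fun s hs _ => ?_
  rw [setLIntegral_condLExp_trim hF _ _ hs, setLIntegral_trim hF hY hs]
  exact h s hs

theorem condLExp_le_const [IsProbabilityMeasure μ] (hF : F ≤ m0) {X : Ω → ℝ≥0∞} {c : ℝ≥0∞}
    (h : ∀ s, MeasurableSet[F] s → ∫⁻ ω in s, X ω ∂μ ≤ c * μ s) :
    ∀ᵐ ω ∂μ, μ⁻[X|F] ω ≤ c :=
  condLExp_le_of_forall_setLIntegral_le hF measurable_const fun s hs => by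
    simpa using h s hs

theorem setLIntegral_le_of_condLExp_le [IsProbabilityMeasure μ] (hF : F ≤ m0) {X : Ω → ℝ≥0∞}
    {c : ℝ≥0∞} (h : ∀ᵐ ω ∂μ, μ⁻[X|F] ω ≤ c) {s : Set Ω} (hs : MeasurableSet[F] s) :
    ∫⁻ ω in s, X ω ∂μ ≤ c * μ s := by
  rw [← setLIntegral_condLExp hF μ X hs]
  refine (lintegral_mono_ae (ae_restrict_of_ae h)).trans ?_
  simp

theorem condLExp_le_smul_add [IsProbabilityMeasure μ] {X X₁ X₂ X₃ : Ω → ℝ≥0∞}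
    {c₁ c₂ B : ℝ≥0∞} (hc₁ : c₁ ≠ ∞) (hc₂ : c₂ ≠ ∞) (hX₂ : AEMeasurable X₂ μ)
    (hX₃ : AEMeasurable X₃ μ)
    (hX : ∀ᵐ ω ∂μ, X ω ≤ c₁ * X₁ ω + c₂ * (X₂ ω + X₃ ω))
    (h₂ : ∀ᵐ ω ∂μ, μ⁻[X₂|F] ω ≤ B) (h₃ : ∀ᵐ ω ∂μ, μ⁻[X₃|F] ω ≤ B) :
    ∀ᵐ ω ∂μ, μ⁻[X|F] ω ≤ c₁ * μ⁻[X₁|F] ω + c₂ * (B + B) := by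
  have e0 : μ⁻[X|F] ≤ᵐ[μ] μ⁻[c₁ • X₁ + c₂ • (X₂ + X₃)|F] := condLExp_mono hX
  have e1 : μ⁻[c₁ • X₁ + c₂ • (X₂ + X₃)|F] =ᵐ[μ] μ⁻[c₁ • X₁|F] + μ⁻[c₂ • (X₂ + X₃)|F] :=
    condLExp_add_right _ ((hX₂.add hX₃).const_smul c₂)
  have e2 := condLExp_smul' (P := μ) (mΩ := F) X₁ hc₁
  have e3 := condLExp_smul' (P := μ) (mΩ := F) (X₂ + X₃) hc₂
  have e4 := condLExp_add_left (P := μ) (mΩ := F) X₃ hX₂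
  filter_upwards [e0, e1, e2, e3, e4, h₂, h₃] with ω a0 a1 a2 a3 a4 b2 b3
  rw [a1, Pi.add_apply, a2, a3, Pi.smul_apply, Pi.smul_apply, a4, Pi.add_apply, smul_eq_mul,
    smul_eq_mul] at a0
  refine a0.trans ?_
  gcongr

end CondLExp

/-! ### Fresh draws -/

section Freezing

variable {Ω S : Type*} [MeasurableSpace S] {F m0 : MeasurableSpace Ω} {μ : Measure[m0] Ω}
  {ρ : Ω → S}

theorem map_restrict_eq_smul_of_indep (hρ : Measurable[m0] ρ)
    (hind : Indep F (MeasurableSpace.comap ρ inferInstance) μ) {s : Set Ω}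
    (hs : MeasurableSet[F] s) : (μ.restrict s).map ρ = μ s • μ.map ρ := by
  ext B hB
  rw [Measure.map_apply hρ hB, Measure.restrict_apply (hρ hB), Set.inter_comm,
    (Indep_iff _ _ _).1 hind s (ρ ⁻¹' B) hs ⟨B, hB, rfl⟩, Measure.smul_apply,
    Measure.map_apply hρ hB, smul_eq_mul]

/-- On every event of the past, a fresh draw `ρ` is independent of the past variable `x`. -/
theorem map_prodMk_restrict_of_indep [IsProbabilityMeasure μ] {E : Type*} [MeasurableSpace E]
    (hF : F ≤ m0) {x : Ω → E} (hx : Measurable[F] x) (hρ : Measurable[m0] ρ)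
    (hind : Indep F (MeasurableSpace.comap ρ inferInstance) μ) {s : Set Ω}
    (hs : MeasurableSet[F] s) :
    (μ.restrict s).map (fun ω => (x ω, ρ ω)) = ((μ.restrict s).map x).prod (μ.map ρ) := by
  have hx0 : Measurable[m0] x := hx.mono hF le_rfl
  refine (Measure.prod_eq fun A B hA hB => ?_).symm
  rw [Measure.map_apply (hx0.prodMk hρ) (hA.prod hB), Measure.map_apply hx0 hA,
    Measure.restrict_apply ((hx0.prodMk hρ) (hA.prod hB)), Measure.restrict_apply (hx0 hA),
    Measure.map_apply hρ hB, ← (Indep_iff _ _ _).1 hind (x ⁻¹' A ∩ s) (ρ ⁻¹' B)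
      ((hx hA).inter hs) ⟨B, hB, rfl⟩]
  congr 1
  ext ω
  simp only [Set.mem_inter_iff, Set.mem_preimage, Set.mem_prod]
  tauto

/-- Freezing the past, for vector-valued functions that are integrable only on the event `s`. -/
theorem integrableOn_and_setIntegral_of_indep [IsProbabilityMeasure μ] {E G : Type*}
    [MeasurableSpace E] [NormedAddCommGroup G] [NormedSpace ℝ G]
    (hF : F ≤ m0) {x : Ω → E} (hx : Measurable[F] x) (hρ : Measurable[m0] ρ)
    (hind : Indep F (MeasurableSpace.comap ρ inferInstance) μ) {Γ : E → S → G}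
    (hΓ : StronglyMeasurable (Function.uncurry Γ)) {s : Set Ω} (hs : MeasurableSet[F] s)
    (hint : IntegrableOn (fun ω => Γ (x ω) (ρ ω)) s μ) :
    IntegrableOn (fun ω => ∫ z, Γ (x ω) z ∂μ.map ρ) s μ ∧
      ∫ ω in s, ∫ z, Γ (x ω) z ∂μ.map ρ ∂μ = ∫ ω in s, Γ (x ω) (ρ ω) ∂μ := by
  have hx0 : Measurable[m0] x := hx.mono hF le_rfl
  have hlaw := map_prodMk_restrict_of_indep hF hx hρ hind hs
  have hpair : AEMeasurable (fun ω => (x ω, ρ ω)) (μ.restrict s) :=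
    (hx0.prodMk hρ).aemeasurable
  have hi : Integrable (Function.uncurry Γ) (((μ.restrict s).map x).prod (μ.map ρ)) := by
    rw [← hlaw, integrable_map_measure hΓ.aestronglyMeasurable hpair]
    exact hint
  have := Measure.isProbabilityMeasure_map (μ := μ) hρ.aemeasurable
  have hmeas : StronglyMeasurable fun y => ∫ z, Γ y z ∂μ.map ρ := hΓ.integral_prod_right
  constructor
  · have h1 : Integrable (fun y => ∫ z, Γ y z ∂μ.map ρ) ((μ.restrict s).map x) :=
      hi.integral_prod_left
    exact (integrable_map_measure hmeas.aestronglyMeasurable hx0.aemeasurable).1 h1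
  · have h1 : ∫ p, Function.uncurry Γ p ∂(μ.restrict s).map (fun ω => (x ω, ρ ω)) =
        ∫ ω in s, Γ (x ω) (ρ ω) ∂μ :=
      integral_map hpair hΓ.aestronglyMeasurable
    have h2 : ∫ y, ∫ z, Γ y z ∂μ.map ρ ∂(μ.restrict s).map x =
        ∫ ω in s, ∫ z, Γ (x ω) z ∂μ.map ρ ∂μ :=
      integral_map hx0.aemeasurable hmeas.aestronglyMeasurable
    rw [← h1, ← h2, hlaw, integral_prod _ hi]
    rfl

/-- Freezing the past: the conditional expectation of a function of the past variable and of a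
fresh draw is at most its average over the draw. -/
theorem condLExp_freeze_le [IsProbabilityMeasure μ] {E : Type*}
    [MeasurableSpace E] (hF : F ≤ m0) {x : Ω → E} (hx : Measurable[F] x) (hρ : Measurable[m0] ρ)
    (hind : Indep F (MeasurableSpace.comap ρ inferInstance) μ) {Γ : E → S → ℝ≥0∞}
    (hΓ : Measurable (Function.uncurry Γ)) :
    ∀ᵐ ω ∂μ, μ⁻[fun ω => Γ (x ω) (ρ ω)|F] ω ≤ ∫⁻ z, Γ (x ω) z ∂μ.map ρ := by
  have hx0 : Measurable[m0] x := hx.mono hF le_rfl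
  have := Measure.isProbabilityMeasure_map (μ := μ) hρ.aemeasurable
  have hmeas : Measurable fun y => ∫⁻ z, Γ y z ∂μ.map ρ := hΓ.lintegral_prod_right
  refine condLExp_le_of_forall_setLIntegral_le hF (hmeas.comp hx) fun s hs => le_of_eq ?_
  have h1 : ∫⁻ p, Function.uncurry Γ p ∂(μ.restrict s).map (fun ω => (x ω, ρ ω)) =
      ∫⁻ ω in s, Γ (x ω) (ρ ω) ∂μ := lintegral_map hΓ (hx0.prodMk hρ)
  have h2 : ∫⁻ y, ∫⁻ z, Γ y z ∂μ.map ρ ∂(μ.restrict s).map x =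
      ∫⁻ ω in s, ∫⁻ z, Γ (x ω) z ∂μ.map ρ ∂μ := lintegral_map hmeas hx0
  rw [← h1, ← h2, map_prodMk_restrict_of_indep hF hx hρ hind hs,
    lintegral_prod _ hΓ.aemeasurable]
  rfl

theorem condLExp_comp_le_of_indep [IsProbabilityMeasure μ] (hF : F ≤ m0) (hρ : Measurable[m0] ρ)
    (hind : Indep F (MeasurableSpace.comap ρ inferInstance) μ) {k : S → ℝ≥0∞}
    (hk : Measurable k) :
    ∀ᵐ ω ∂μ, μ⁻[fun ω => k (ρ ω)|F] ω ≤ ∫⁻ z, k z ∂μ.map ρ := by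
  refine condLExp_le_const hF fun s hs => le_of_eq ?_
  rw [← lintegral_map hk hρ, map_restrict_eq_smul_of_indep hρ hind hs, lintegral_smul_measure,
    smul_eq_mul, mul_comm]

end Freezing

/-! ### Noise -/

section Noise

variable {Ω S : Type*} [MeasurableSpace S] {F m0 : MeasurableSpace Ω} {μ : Measure[m0] Ω}
  {ρ : Ω → S}

theorem HasNoiseLevel.isTsybakovNoise [IsProbabilityMeasure μ] (hF : F ≤ m0) {d : ℕ}
    {q : Ω → Eucl d} {ξ : Ω → ℝ} {δ : ℝ} (h : HasNoiseLevel μ F q ξ δ) :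
    IsTsybakovNoise μ F ξ δ := by
  rcases h with h | ⟨e, he, hξ⟩
  · exact h
  · refine condLExp_le_const hF fun s _ => ?_
    refine (lintegral_mono (g := fun _ => ENNReal.ofReal (δ ^ 2)) fun ω => ?_).trans (by simp)
    rw [hξ]
    exact ENNReal.ofReal_le_ofReal (sq_le_sq.2 ((he _).trans (le_abs_self _)))

theorem IsTsybakovNoise.lintegral_le [IsProbabilityMeasure μ] (hF : F ≤ m0)
    {ξ : Ω → ℝ} {δ : ℝ} (h : IsTsybakovNoise μ F ξ δ) :
    ∫⁻ ω, ENNReal.ofReal (ξ ω ^ 2) ∂μ ≤ ENNReal.ofReal (δ ^ 2) := by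
  have := setLIntegral_le_of_condLExp_le hF h (MeasurableSet.univ)
  simpa using this

/-- If the noise has level `δ` given the fresh draw too, then a weight depending on the draw
factors out. -/
theorem IsTsybakovNoise.condLExp_mul_comp_le [IsProbabilityMeasure μ] (hF : F ≤ m0)
    (hρ : Measurable[m0] ρ) (hind : Indep F (MeasurableSpace.comap ρ inferInstance) μ)
    {ξ : Ω → ℝ} (hξ : Measurable[m0] ξ) {δ : ℝ}
    (h : IsTsybakovNoise μ (F ⊔ MeasurableSpace.comap ρ inferInstance) ξ δ)
    {k : S → ℝ≥0∞} (hk : Measurable k) :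
    ∀ᵐ ω ∂μ, μ⁻[fun ω => ENNReal.ofReal (ξ ω ^ 2) * k (ρ ω)|F] ω ≤
      ENNReal.ofReal (δ ^ 2) * ∫⁻ z, k z ∂μ.map ρ := by
  have hm : F ⊔ MeasurableSpace.comap ρ inferInstance ≤ m0 := sup_le hF hρ.comap_le
  have hX : Measurable[m0] fun ω => ENNReal.ofReal (ξ ω ^ 2) := by fun_prop
  refine condLExp_le_const hF fun s hs => ?_
  have hsm : MeasurableSet[F ⊔ MeasurableSpace.comap ρ inferInstance] s :=
    (le_sup_left : F ≤ F ⊔ MeasurableSpace.comap ρ inferInstance) s hs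
  have hkm : Measurable[F ⊔ MeasurableSpace.comap ρ inferInstance] fun ω => k (ρ ω) :=
    (hk.comp (comap_measurable ρ)).mono le_sup_right le_rfl
  have hle : (μ.withDensity fun ω => ENNReal.ofReal (ξ ω ^ 2)).trim hm ≤
      ENNReal.ofReal (δ ^ 2) • μ.trim hm := by
    refine Measure.le_iff.2 fun t ht => ?_
    rw [trim_measurableSet_eq hm ht, withDensity_apply _ (hm t ht), Measure.smul_apply,
      trim_measurableSet_eq hm ht, smul_eq_mul]
    exact setLIntegral_le_of_condLExp_le hm h ht
  calc ∫⁻ ω in s, ENNReal.ofReal (ξ ω ^ 2) * k (ρ ω) ∂μ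
      = ∫⁻ ω in s, k (ρ ω) ∂(μ.withDensity fun ω => ENNReal.ofReal (ξ ω ^ 2)) := by
        exact (setLIntegral_withDensity_eq_setLIntegral_mul _ hX (hk.comp hρ) (hF s hs)).symm
    _ = ∫⁻ ω in s, k (ρ ω) ∂(μ.withDensity fun ω => ENNReal.ofReal (ξ ω ^ 2)).trim hm :=
        (setLIntegral_trim hm hkm hsm).symm
    _ ≤ ∫⁻ ω in s, k (ρ ω) ∂(ENNReal.ofReal (δ ^ 2) • μ.trim hm) :=
        lintegral_mono' (Measure.restrict_mono le_rfl hle) le_rfl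
    _ = ENNReal.ofReal (δ ^ 2) * ∫⁻ ω in s, k (ρ ω) ∂μ := by
        rw [Measure.restrict_smul, lintegral_smul_measure, setLIntegral_trim hm hkm hsm,
          smul_eq_mul]
    _ = ENNReal.ofReal (δ ^ 2) * (∫⁻ z, k z ∂μ.map ρ) * μ s := by
        rw [← lintegral_map hk hρ, map_restrict_eq_smul_of_indep hρ hind hs,
          lintegral_smul_measure, smul_eq_mul]
        ring

/-- A conditional Cauchy–Schwarz bound, in the form given by the inequality
`|ξ w| ≤ (ξ² / δ + δ w²) / 2`. -/
theorem condLExp_abs_mul_le [IsProbabilityMeasure μ] (hF : F ≤ m0) {ξ w : Ω → ℝ}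
    (hξ : Measurable[m0] ξ) {δ κ : ℝ} (hδ : 0 ≤ δ) (hκ : 0 ≤ κ)
    (h : IsTsybakovNoise μ F ξ δ)
    (hwκ : ∀ᵐ ω ∂μ, μ⁻[fun ω => ENNReal.ofReal (w ω ^ 2)|F] ω ≤ ENNReal.ofReal κ) :
    ∀ᵐ ω ∂μ, μ⁻[(fun ω => ENNReal.ofReal |ξ ω * w ω|)|F] ω ≤ ENNReal.ofReal (δ * (1 + κ) / 2) := by
  -- for `δ = 0` the inequality with `1 / δ` is not available, but then the noise vanishes
  rcases hδ.eq_or_lt with rfl | hδ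
  · have h0 : ∫⁻ ω, ENNReal.ofReal (ξ ω ^ 2) ∂μ = 0 := by simpa using h.lintegral_le hF
    rw [lintegral_eq_zero_iff (by fun_prop)] at h0
    have h1 : (fun ω => ENNReal.ofReal |ξ ω * w ω|) =ᵐ[μ] fun _ => 0 := by
      filter_upwards [h0] with ω hω
      have : ξ ω = 0 := by
        have h2 : ξ ω ^ 2 ≤ 0 := by simpa using hω
        exact pow_eq_zero_iff two_ne_zero |>.1 (le_antisymm h2 (sq_nonneg _))
      simp [this]
    filter_upwards [condLExp_congr_ae (mΩ := F) h1] with ω a1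
    rw [a1]
    exact (le_of_eq (congrFun (condLExp_zero (mΩ := F) μ) ω)).trans (by simp)
  · have hκ' : ∀ᵐ ω ∂μ, μ⁻[ENNReal.ofReal (δ / 2) • fun ω => ENNReal.ofReal (w ω ^ 2)|F] ω ≤
        ENNReal.ofReal (δ / 2) * ENNReal.ofReal κ := by
      filter_upwards [hwκ, condLExp_smul' (P := μ) (mΩ := F)
        (fun ω => ENNReal.ofReal (w ω ^ 2)) (ENNReal.ofReal_ne_top (r := δ / 2))] with ω a1 a2
      rw [a2, Pi.smul_apply, smul_eq_mul]
      gcongr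
    have e0 : μ⁻[(fun ω => ENNReal.ofReal |ξ ω * w ω|)|F] ≤ᵐ[μ]
        μ⁻[(ENNReal.ofReal (1 / (2 * δ)) • fun ω => ENNReal.ofReal (ξ ω ^ 2)) +
          ENNReal.ofReal (δ / 2) • fun ω => ENNReal.ofReal (w ω ^ 2)|F] := by
      refine condLExp_mono (Filter.Eventually.of_forall fun ω => ?_)
      simp only [Pi.add_apply, Pi.smul_apply, smul_eq_mul]
      rw [← ENNReal.ofReal_mul (by positivity), ← ENNReal.ofReal_mul (by positivity),
        ← ENNReal.ofReal_add (by positivity) (by positivity)]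
      refine ENNReal.ofReal_le_ofReal ?_
      rw [abs_mul, ← sq_abs (ξ ω), ← sq_abs (w ω)]
      have h1 : 1 / (2 * δ) * |ξ ω| ^ 2 + δ / 2 * |w ω| ^ 2 - |ξ ω| * |w ω| =
          (|ξ ω| - δ * |w ω|) ^ 2 / (2 * δ) := by
        field_simp
        ring
      have h2 : 0 ≤ (|ξ ω| - δ * |w ω|) ^ 2 / (2 * δ) := by positivity
      linarith
    have e1 := condLExp_add_left (P := μ) (mΩ := F)
      (X := ENNReal.ofReal (1 / (2 * δ)) • fun ω => ENNReal.ofReal (ξ ω ^ 2))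
      (ENNReal.ofReal (δ / 2) • fun ω => ENNReal.ofReal (w ω ^ 2))
      ((by fun_prop : Measurable fun ω => ENNReal.ofReal (ξ ω ^ 2)).aemeasurable.const_smul _)
    have e2 := condLExp_smul' (P := μ) (mΩ := F) (fun ω => ENNReal.ofReal (ξ ω ^ 2))
      (ENNReal.ofReal_ne_top (r := 1 / (2 * δ)))
    filter_upwards [e0, e1, e2, hκ', h] with ω a0 a1 a2 a3 a4
    rw [a1, Pi.add_apply, a2, Pi.smul_apply, smul_eq_mul] at a0
    refine a0.trans ((add_le_add (mul_le_mul_right a4 _) a3).trans (le_of_eq ?_))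
    rw [← ENNReal.ofReal_mul (by positivity), ← ENNReal.ofReal_mul (by positivity),
      ← ENNReal.ofReal_add (by positivity) (by positivity)]
    congr 1
    field_simp

end Noise

/-! ### Conditional means -/

section CondMean

variable {Ω E G : Type*} [NormedAddCommGroup G] [NormedSpace ℝ G] [CompleteSpace G]
  {F m0 : MeasurableSpace Ω} {μ : Measure[m0] Ω}

theorem integrable_and_norm_condExp_le_of_condLExp_enorm_le [IsProbabilityMeasure μ]
    (hF : F ≤ m0) {N : Ω → G} (hN : AEStronglyMeasurable N μ) {c : ℝ} (hc : 0 ≤ c)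
    (h : ∀ᵐ ω ∂μ, μ⁻[fun ω => ‖N ω‖ₑ|F] ω ≤ ENNReal.ofReal c) :
    Integrable N μ ∧ ∀ᵐ ω ∂μ, ‖(μ[N|F]) ω‖ ≤ c := by
  have hfin : ∫⁻ ω, ‖N ω‖ₑ ∂μ ≠ ∞ := by
    have h1 := setLIntegral_le_of_condLExp_le hF h MeasurableSet.univ
    simp only [Measure.restrict_univ, measure_univ, mul_one] at h1
    exact ne_top_of_le_ne_top ENNReal.ofReal_ne_top h1
  refine ⟨⟨hN, hfin.lt_top⟩, ?_⟩
  have h2 := toReal_condLExp F hN.enorm hfin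
  simp only [toReal_enorm] at h2
  filter_upwards [h, h2, norm_condExp_le (μ := μ) (m := F) N] with ω a1 a2 a3
  refine a3.trans (a2 ▸ ?_)
  exact ENNReal.toReal_le_of_le_ofReal hc a1

/-- The conditional mean of a conditionally integrable function of the past and of a fresh draw,
perturbed by an integrable term. -/
theorem hasCondMean_integral_add_condExp [IsProbabilityMeasure μ] {S : Type*} [MeasurableSpace S]
    [MeasurableSpace E] (hF : F ≤ m0) {x : Ω → E} (hx : Measurable[F] x) {ρ : Ω → S}
    (hρ : Measurable[m0] ρ) (hind : Indep F (MeasurableSpace.comap ρ inferInstance) μ)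
    {Γ : E → S → G} (hΓ : StronglyMeasurable (Function.uncurry Γ))
    (hΓi : ∀ y, Integrable (Γ y) (μ.map ρ)) {N X : Ω → G} (hN : Integrable N μ)
    (hX : X =ᵐ[μ] fun ω => Γ (x ω) (ρ ω) + N ω) :
    HasCondMean μ F X fun ω => ∫ z, Γ (x ω) z ∂μ.map ρ + (μ[N|F]) ω := by
  have := Measure.isProbabilityMeasure_map (μ := μ) hρ.aemeasurable
  have hx0 : Measurable[m0] x := hx.mono hF le_rfl
  have hΓm : AEStronglyMeasurable (fun ω => Γ (x ω) (ρ ω)) μ :=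
    (hΓ.comp_measurable (hx0.prodMk hρ)).aestronglyMeasurable
  have hset : ∀ s, IntegrableOn X s μ → IntegrableOn (fun ω => Γ (x ω) (ρ ω)) s μ := by
    intro s hs
    refine (hs.sub hN.integrableOn).congr ?_
    filter_upwards [ae_restrict_of_ae hX] with ω hω
    simp [hω]
  refine ⟨(hΓm.add hN.aestronglyMeasurable).congr hX.symm, ?_, ?_, fun s hs hXs => ?_,
    fun s hs hXs => ?_⟩
  · have h1 : StronglyMeasurable[F] fun ω => ∫ z, Γ (x ω) z ∂μ.map ρ :=
      hΓ.integral_prod_right.comp_measurable hx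
    exact (h1.add stronglyMeasurable_condExp).aestronglyMeasurable
  · have e0 : μ⁻[fun ω => ‖X ω‖ₑ|F] ≤ᵐ[μ]
        μ⁻[(fun ω => ‖Γ (x ω) (ρ ω)‖ₑ) + fun ω => ‖N ω‖ₑ|F] :=
      condLExp_mono (hX.mono fun ω hω => by
        simp only [hω, Pi.add_apply]
        exact enorm_add_le _ _)
    have e1 := condLExp_add_left (P := μ) (mΩ := F) (fun ω => ‖N ω‖ₑ) hΓm.enorm
    have e2 := condLExp_freeze_le hF hx hρ hind (Γ := fun y z => ‖Γ y z‖ₑ) hΓ.enorm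
    have e3 := condLExp_lt_top (P := μ) (mΩ := F) hN.hasFiniteIntegral.ne
    filter_upwards [e0, e1, e2, e3] with ω a0 a1 a2 a3
    rw [a1] at a0
    exact a0.trans_lt (ENNReal.add_lt_top.2 ⟨a2.trans_lt (hΓi (x ω)).hasFiniteIntegral, a3⟩)
  · exact (integrableOn_and_setIntegral_of_indep hF hx hρ hind hΓ hs (hset s hXs)).1.add
      integrable_condExp.integrableOn
  · have h1 := integrableOn_and_setIntegral_of_indep hF hx hρ hind hΓ hs (hset s hXs)
    have h3 : ∫ ω in s, X ω ∂μ = ∫ ω in s, (Γ (x ω) (ρ ω) + N ω) ∂μ :=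
      integral_congr_ae (ae_restrict_of_ae hX)
    rw [h3, integral_add h1.1 integrable_condExp.integrableOn,
      integral_add (hset s hXs) hN.integrableOn, h1.2, setIntegral_condExp hF hN hs]

end CondMean

/-! ### The two-point estimator -/

theorem twoPointEstimator_add {d : ℕ} (K : ℝ → ℝ) (h r : ℝ) (ζ : Metric.sphere (0 : Eucl d) 1)
    (a b p q : ℝ) : twoPointEstimator K h r ζ (a + p) (b + q) =
      twoPointEstimator K h r ζ a b + twoPointEstimator K h r ζ p q := by
  simp only [twoPointEstimator, ← add_smul]
  congr 1
  ring

theorem norm_twoPointEstimator {d : ℕ} (K : ℝ → ℝ) {h : ℝ} (hh : 0 < h) (r : ℝ)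
    (ζ : Metric.sphere (0 : Eucl d) 1) (a b : ℝ) :
    ‖twoPointEstimator K h r ζ a b‖ = (d : ℝ) / (2 * h) * |(a - b) * K r| := by
  rw [twoPointEstimator, norm_smul, mul_assoc, norm_mul, Real.norm_eq_abs, Real.norm_eq_abs,
    abs_of_nonneg (by positivity : 0 ≤ (d : ℝ) / (2 * h))]
  simp

theorem sq_norm_twoPointEstimator_add_le {d : ℕ} (K : ℝ → ℝ) {h : ℝ} (hh : 0 < h) (r : ℝ)
    (ζ : Metric.sphere (0 : Eucl d) 1) (a b p q : ℝ) :
    ‖twoPointEstimator K h r ζ (a + p) (b + q)‖ ^ 2 ≤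
      3 * ‖twoPointEstimator K h r ζ a b‖ ^ 2 +
        3 * ((d : ℝ) / (2 * h)) ^ 2 * (p ^ 2 * K r ^ 2 + q ^ 2 * K r ^ 2) := by
  simp only [norm_twoPointEstimator K hh, mul_pow, sq_abs]
  have key : (a + p - (b + q)) ^ 2 ≤ 3 * (a - b) ^ 2 + 3 * (p ^ 2 + q ^ 2) := by
    nlinarith [sq_nonneg (a - b - p), sq_nonneg (a - b + q), sq_nonneg (p + q)]
  have hnn : 0 ≤ ((d : ℝ) / (2 * h)) ^ 2 * K r ^ 2 := by positivity
  nlinarith [mul_le_mul_of_nonneg_left key hnn]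

theorem IsSmoothingKernel.congr_ae {β : ℝ} {K K' : ℝ → ℝ} (hK : IsSmoothingKernel β K)
    (h : K =ᵐ[unifInterval] K') : IsSmoothingKernel β K' := by
  refine ⟨(memLp_congr_ae h).1 hK.sq_integrable, hK.integrable_rpow.congr ?_, ?_, ?_,
    fun h2 j hj hjl => ?_⟩
  · filter_upwards [h] with u hu
    rw [hu]
  · rw [← hK.moment_zero]
    exact integral_congr_ae h.symm
  · rw [← hK.moment_one]
    refine integral_congr_ae ?_
    filter_upwards [h] with u hu
    rw [hu]
  · rw [← hK.higher_moments h2 j hj hjl]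
    refine integral_congr_ae ?_
    filter_upwards [h] with u hu
    rw [hu]

section Estimator

variable {d : ℕ} {Ω : Type*} {F m0 : MeasurableSpace Ω} {μ : Measure[m0] Ω}
  {ρ : Ω → ℝ × Metric.sphere (0 : Eucl d) 1}

theorem map_prodMk_eq_drawLaw [IsProbabilityMeasure μ] {r : Ω → ℝ}
    {ζ : Ω → Metric.sphere (0 : Eucl d) 1} (hr : Measurable[m0] r) (hζ : Measurable[m0] ζ)
    (hr_unif : pdf.IsUniform r (Set.Icc (-1) 1) μ volume)
    (hζ_unif : pdf.IsUniform ζ Set.univ μ (volume : Measure (Eucl d)).toSphere)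
    (hrζ : IndepFun r ζ μ) : μ.map (fun ω => (r ω, ζ ω)) = drawLaw d := by
  rw [(indepFun_iff_map_prod_eq_prod_map_map hr.aemeasurable hζ.aemeasurable).1 hrζ,
    show μ.map r = unifInterval from hr_unif]
  exact congrArg _ hζ_unif

theorem map_fst_eq_unifInterval (hd : 1 ≤ d) (hρ : Measurable[m0] ρ)
    (hlaw : μ.map ρ = drawLaw d) : μ.map (fun ω => (ρ ω).1) = unifInterval := by
  have := isProbabilityMeasure_unifSphere hd
  have := isProbabilityMeasure_unifInterval
  have h1 : (μ.map ρ).map Prod.fst = μ.map fun ω => (ρ ω).1 := Measure.map_map measurable_fst hρ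
  rw [← h1, hlaw, drawLaw, Measure.map_fst_prod]
  simp

theorem ae_comp_fst_of_ae_unifInterval (hd : 1 ≤ d) (hρ : Measurable[m0] ρ)
    (hlaw : μ.map ρ = drawLaw d) {P : ℝ → Prop} (hP : ∀ᵐ u ∂unifInterval, P u) :
    ∀ᵐ ω ∂μ, P (ρ ω).1 := by
  rw [← map_fst_eq_unifInterval hd hρ hlaw] at hP
  exact ae_of_ae_map hρ.fst.aemeasurable hP

theorem lintegral_sq_kernel_map_eq (hd : 1 ≤ d) (hρ : Measurable[m0] ρ)
    (hlaw : μ.map ρ = drawLaw d) {K : ℝ → ℝ} (hKm : Measurable K) (hK : MemLp K 2 unifInterval) :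
    ∫⁻ z, ENNReal.ofReal (K z.1 ^ 2) ∂μ.map ρ = ENNReal.ofReal (∫ u, K u ^ 2 ∂unifInterval) := by
  have hKs : Measurable fun u => ENNReal.ofReal (K u ^ 2) := (hKm.pow_const 2).ennreal_ofReal
  have h1 : ∫⁻ z, ENNReal.ofReal (K z.1 ^ 2) ∂μ.map ρ =
      ∫⁻ ω, ENNReal.ofReal (K (ρ ω).1 ^ 2) ∂μ := lintegral_map (hKs.comp measurable_fst) hρ
  rw [h1, ofReal_integral_eq_lintegral_ofReal hK.integrable_sq
    (Filter.Eventually.of_forall fun u => sq_nonneg _),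
    ← map_fst_eq_unifInterval hd hρ hlaw, lintegral_map hKs hρ.fst]

/-- The bias of the noisy estimator: the noise part is integrable, and its conditional mean is
controlled by a conditional Cauchy–Schwarz inequality. -/
theorem exists_hasCondMean_twoPointEstimator [IsProbabilityMeasure μ] (hd : 1 ≤ d) {β L δ h : ℝ}
    (hβ : 2 ≤ β) {K : ℝ → ℝ} (hK : IsSmoothingKernel β K) (hδ : 0 ≤ δ) (hh : 0 < h)
    {f : Eucl d → ℝ} (hf : HolderSmooth β L f) (hF : F ≤ m0) {x : Ω → Eucl d}
    (hx : Measurable[F] x) (hρ : Measurable[m0] ρ) (hlaw : μ.map ρ = drawLaw d)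
    (hfresh : Indep F (MeasurableSpace.comap ρ inferInstance) μ) {ξp ξm : Ω → ℝ}
    (hξp : Measurable[m0] ξp) (hξm : Measurable[m0] ξm) (hbp : IsTsybakovNoise μ F ξp δ)
    (hbm : IsTsybakovNoise μ F ξm δ) {g : Ω → Eucl d}
    (hg : ∀ ω, g ω = estimatorAt K h f (x ω) (ρ ω) +
      twoPointEstimator K h (ρ ω).1 (ρ ω).2 (ξp ω) (ξm ω)) :
    ∃ b : Ω → Eucl d, HasCondMean μ F g (fun ω => gradient f (x ω) + b ω) ∧
      ∀ᵐ ω ∂μ, ‖b ω‖ ≤ 2 * L * h ^ (β - 1) * ∫ u, |u| ^ β * |K u| ∂unifInterval +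
        (d : ℝ) / (2 * h) * (δ * (1 + ∫ u, K u ^ 2 ∂unifInterval)) := by
  have hfc : Continuous f := hf.contDiff.continuous
  -- a Borel version of the kernel, which agrees with it almost surely at the drawn scalar
  obtain ⟨K', hK'm, hKK'⟩ := hK.sq_integrable.aestronglyMeasurable
  have hK' := hK.congr_ae hKK'
  have hKr : ∀ᵐ ω ∂μ, K (ρ ω).1 = K' (ρ ω).1 := ae_comp_fst_of_ae_unifInterval hd hρ hlaw hKK'
  have hκβ : ∫ u, |u| ^ β * |K u| ∂unifInterval = ∫ u, |u| ^ β * |K' u| ∂unifInterval := by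
    refine integral_congr_ae ?_
    filter_upwards [hKK'] with u hu
    rw [hu]
  have hκ : ∫ u, K u ^ 2 ∂unifInterval = ∫ u, K' u ^ 2 ∂unifInterval := by
    refine integral_congr_ae ?_
    filter_upwards [hKK'] with u hu
    rw [hu]
  rw [hκβ, hκ]
  have hκl := lintegral_sq_kernel_map_eq hd hρ hlaw hK'm.measurable hK'.sq_integrable
  have hκ0 : 0 ≤ ∫ u, K' u ^ 2 ∂unifInterval := integral_nonneg fun u => by positivity
  have hK'r : Measurable[m0] fun ω => K' (ρ ω).1 := hK'm.measurable.comp hρ.fst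
  have hKsq : Measurable fun z : ℝ × Metric.sphere (0 : Eucl d) 1 =>
      ENNReal.ofReal (K' z.1 ^ 2) :=
    ((hK'm.measurable.comp measurable_fst).pow_const 2).ennreal_ofReal
  -- the noise part of the estimator is integrable, with a bounded conditional mean
  let N : Ω → Eucl d := fun ω => twoPointEstimator K' h (ρ ω).1 (ρ ω).2 (ξp ω) (ξm ω)
  have hNm : Measurable[m0] N := by
    have h1 : Measurable[m0] fun ω => ((ρ ω).2 : Eucl d) := measurable_subtype_coe.comp hρ.snd
    exact (((hξp.sub hξm).const_mul _).mul hK'r).smul h1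
  have hw : ∀ᵐ ω ∂μ, μ⁻[fun ω => ENNReal.ofReal (K' (ρ ω).1 ^ 2)|F] ω ≤
      ENNReal.ofReal (∫ u, K' u ^ 2 ∂unifInterval) := by
    rw [← hκl]
    exact condLExp_comp_le_of_indep hF hρ hfresh hKsq
  have hNl : ∀ᵐ ω ∂μ, μ⁻[fun ω => ‖N ω‖ₑ|F] ω ≤
      ENNReal.ofReal ((d : ℝ) / (2 * h) * (δ * (1 + ∫ u, K' u ^ 2 ∂unifInterval))) := by
    have h1 := condLExp_le_smul_add (F := F) (μ := μ) (X := fun ω => ‖N ω‖ₑ)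
      (X₁ := fun _ => 0) (X₂ := fun ω => ENNReal.ofReal |ξp ω * K' (ρ ω).1|)
      (X₃ := fun ω => ENNReal.ofReal |ξm ω * K' (ρ ω).1|) (c₁ := 0)
      (c₂ := ENNReal.ofReal ((d : ℝ) / (2 * h))) ENNReal.zero_ne_top ENNReal.ofReal_ne_top
      (hξp.mul hK'r).abs.ennreal_ofReal.aemeasurable
      (hξm.mul hK'r).abs.ennreal_ofReal.aemeasurable
      (Filter.Eventually.of_forall fun ω => ?_)
      (condLExp_abs_mul_le hF hξp hδ hκ0 hbp hw) (condLExp_abs_mul_le hF hξm hδ hκ0 hbm hw)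
    · filter_upwards [h1] with ω hω
      refine hω.trans (le_of_eq ?_)
      rw [zero_mul, zero_add, ← ENNReal.ofReal_add (by positivity) (by positivity),
        ← ENNReal.ofReal_mul (by positivity)]
      congr 1
      ring
    · rw [zero_mul, zero_add, ← ENNReal.ofReal_add (by positivity) (by positivity),
        ← ENNReal.ofReal_mul (by positivity), ← ofReal_norm,
        norm_twoPointEstimator K' hh, sub_mul]
      exact ENNReal.ofReal_le_ofReal (mul_le_mul_of_nonneg_left (abs_sub _ _) (by positivity))
  obtain ⟨hNi, hNb⟩ := integrable_and_norm_condExp_le_of_condLExp_enorm_le hF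
    hNm.aestronglyMeasurable (by positivity) hNl
  have hΓ : StronglyMeasurable (Function.uncurry (estimatorAt K' h f)) := by
    have h1 : Function.uncurry (estimatorAt K' h f) =
        fun p : Eucl d × (ℝ × Metric.sphere (0 : Eucl d) 1) => K' p.2.1 •
          (((d : ℝ) / (2 * h) * (f (p.1 + (h * p.2.1) • (p.2.2 : Eucl d)) -
            f (p.1 + (-(h * p.2.1)) • (p.2.2 : Eucl d)))) • (p.2.2 : Eucl d)) := by
      ext1 p
      exact estimatorAt_eq_kernel_smul K' h f p.1 p.2
    rw [h1]
    refine (hK'm.comp_measurable (measurable_fst.comp measurable_snd)).smul ?_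
    exact Continuous.stronglyMeasurable (by fun_prop)
  have hmean := hasCondMean_integral_add_condExp hF hx hρ hfresh hΓ
    (fun y => hlaw ▸ integrable_estimatorAt hd hK'.integrable h hfc y) hNi (X := g) (by
      filter_upwards [hKr] with ω hω
      rw [hg]
      simp only [estimatorAt, twoPointEstimator, N, hω])
  rw [hlaw] at hmean
  refine ⟨fun ω => ∫ z, estimatorAt K' h f (x ω) z ∂drawLaw d + (μ[N|F]) ω - gradient f (x ω),
    by simpa using hmean, ?_⟩
  filter_upwards [hNb] with ω hω
  have h1 := norm_integral_estimatorAt_sub_gradient_le hd hβ hK' hh hf (x ω)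
  rw [add_sub_right_comm]
  refine (norm_add_le _ _).trans (add_le_add h1 hω)

/-- The second moment for a kernel that is bounded at the drawn scalar: the bound on the kernel can
be pulled out before taking conditional expectations, so the noise need only be controlled given
the past. -/
theorem condLExp_sq_norm_le_of_bounded [IsProbabilityMeasure μ] {K : ℝ → ℝ} {M δ h : ℝ}
    (hK : ∀ᵐ ω ∂μ, |K (ρ ω).1| ≤ M) (hh : 0 < h) {yp ym ξp ξm : Ω → ℝ}
    (hξp : Measurable[m0] ξp) (hξm : Measurable[m0] ξm) (hbp : IsTsybakovNoise μ F ξp δ)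
    (hbm : IsTsybakovNoise μ F ξm δ) {g : Ω → Eucl d}
    (hg : ∀ ω, g ω = twoPointEstimator K h (ρ ω).1 (ρ ω).2 (yp ω + ξp ω) (ym ω + ξm ω)) {C : ℝ}
    (hC : 3 / 2 * M ^ 2 ≤ C) :
    ∀ᵐ ω ∂μ, μ⁻[fun ω' => ENNReal.ofReal (‖g ω'‖ ^ 2)|F] ω ≤
      ENNReal.ofReal (C * ((d : ℝ) ^ 2 / h ^ 2)) *
          μ⁻[fun ω' => ENNReal.ofReal (|yp ω' - ym ω'| ^ 2)|F] ω +
        ENNReal.ofReal (C * ((d : ℝ) ^ 2 / h ^ 2 * δ ^ 2)) := by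
  set A : ℝ := 3 * ((d : ℝ) / (2 * h)) ^ 2 * M ^ 2 with hA
  have hA0 : 0 ≤ A := by positivity
  have h1 := condLExp_le_smul_add (F := F) (μ := μ)
    (X := fun ω => ENNReal.ofReal (‖g ω‖ ^ 2))
    (X₁ := fun ω => ENNReal.ofReal (|yp ω - ym ω| ^ 2))
    (X₂ := fun ω => ENNReal.ofReal (ξp ω ^ 2)) (X₃ := fun ω => ENNReal.ofReal (ξm ω ^ 2))
    (c₁ := ENNReal.ofReal A) (c₂ := ENNReal.ofReal A) ENNReal.ofReal_ne_top
    ENNReal.ofReal_ne_top (hξp.pow_const 2).ennreal_ofReal.aemeasurable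
    (hξm.pow_const 2).ennreal_ofReal.aemeasurable ?_ hbp hbm
  · have hAC : 2 * A ≤ C * ((d : ℝ) ^ 2 / h ^ 2) := by
      have : 2 * A = 3 / 2 * M ^ 2 * ((d : ℝ) ^ 2 / h ^ 2) := by
        rw [hA]
        field_simp
      rw [this]
      exact mul_le_mul_of_nonneg_right hC (by positivity)
    filter_upwards [h1] with ω hω
    refine hω.trans (add_le_add (mul_le_mul_left
      (ENNReal.ofReal_le_ofReal (by linarith)) _) ?_)
    rw [← ENNReal.ofReal_add (by positivity) (by positivity),
      ← ENNReal.ofReal_mul (by positivity)]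
    refine ENNReal.ofReal_le_ofReal ?_
    calc A * (δ ^ 2 + δ ^ 2) = 2 * A * δ ^ 2 := by ring
      _ ≤ C * ((d : ℝ) ^ 2 / h ^ 2) * δ ^ 2 := by gcongr
      _ = _ := by ring
  · filter_upwards [hK] with ω hω
    have hKM : K (ρ ω).1 ^ 2 ≤ M ^ 2 :=
      sq_le_sq.2 (hω.trans (le_abs_self _))
    rw [← ENNReal.ofReal_add (by positivity) (by positivity),
      ← ENNReal.ofReal_mul (by positivity), ← ENNReal.ofReal_mul (by positivity),
      ← ENNReal.ofReal_add (by positivity) (by positivity), hg]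
    refine ENNReal.ofReal_le_ofReal
      ((sq_norm_twoPointEstimator_add_le K hh _ _ _ _ _ _).trans ?_)
    rw [norm_twoPointEstimator K hh, mul_pow, sq_abs, mul_pow, sq_abs]
    calc _ = 3 * ((d : ℝ) / (2 * h)) ^ 2 * K (ρ ω).1 ^ 2 *
          ((yp ω - ym ω) ^ 2 + (ξp ω ^ 2 + ξm ω ^ 2)) := by ring
      _ ≤ 3 * ((d : ℝ) / (2 * h)) ^ 2 * M ^ 2 *
          ((yp ω - ym ω) ^ 2 + (ξp ω ^ 2 + ξm ω ^ 2)) := by gcongr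
      _ = _ := by
        rw [hA]
        ring

/-- The second moment for an unbounded kernel: noise controlled given the draw too lets
`E[ξ² K(r)² | F] ≤ δ² E[K(r)²]`. -/
theorem condLExp_sq_norm_le_of_fresh [IsProbabilityMeasure μ] (hd : 1 ≤ d) {K : ℝ → ℝ} {δ h : ℝ}
    (hK : MemLp K 2 unifInterval) (hh : 0 < h) (hF : F ≤ m0) (hρ : Measurable[m0] ρ)
    (hlaw : μ.map ρ = drawLaw d) (hfresh : Indep F (MeasurableSpace.comap ρ inferInstance) μ)
    {yp ym ξp ξm : Ω → ℝ} (hξp : Measurable[m0] ξp) (hξm : Measurable[m0] ξm)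
    (hnp : IsTsybakovNoise μ (F ⊔ MeasurableSpace.comap ρ inferInstance) ξp δ)
    (hnm : IsTsybakovNoise μ (F ⊔ MeasurableSpace.comap ρ inferInstance) ξm δ) {g g₀ : Ω → Eucl d}
    (hg : ∀ ω, g ω = twoPointEstimator K h (ρ ω).1 (ρ ω).2 (yp ω + ξp ω) (ym ω + ξm ω))
    (hg₀ : ∀ ω, g₀ ω = twoPointEstimator K h (ρ ω).1 (ρ ω).2 (yp ω) (ym ω)) {C : ℝ}
    (hC3 : 3 ≤ C) (hCκ : 3 / 2 * ∫ u, K u ^ 2 ∂unifInterval ≤ C) :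
    ∀ᵐ ω ∂μ, μ⁻[fun ω' => ENNReal.ofReal (‖g ω'‖ ^ 2)|F] ω ≤
      ENNReal.ofReal C * μ⁻[fun ω' => ENNReal.ofReal (‖g₀ ω'‖ ^ 2)|F] ω +
        ENNReal.ofReal (C * ((d : ℝ) ^ 2 / h ^ 2 * δ ^ 2)) := by
  obtain ⟨K', hK'm, hKK'⟩ := hK.aestronglyMeasurable
  have hKr : ∀ᵐ ω ∂μ, K (ρ ω).1 = K' (ρ ω).1 := ae_comp_fst_of_ae_unifInterval hd hρ hlaw hKK'
  have hK'r : Measurable[m0] fun ω => K' (ρ ω).1 := hK'm.measurable.comp hρ.fst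
  have hKsq : Measurable fun z : ℝ × Metric.sphere (0 : Eucl d) 1 =>
      ENNReal.ofReal (K' z.1 ^ 2) :=
    ((hK'm.measurable.comp measurable_fst).pow_const 2).ennreal_ofReal
  have hκ : ∫ u, K' u ^ 2 ∂unifInterval = ∫ u, K u ^ 2 ∂unifInterval := by
    refine integral_congr_ae ?_
    filter_upwards [hKK'] with u hu
    rw [hu]
  have hκl := lintegral_sq_kernel_map_eq hd hρ hlaw hK'm.measurable ((memLp_congr_ae hKK').1 hK)
  rw [hκ] at hκl
  have hbp' := hnp.condLExp_mul_comp_le hF hρ hfresh hξp hKsq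
  have hbm' := hnm.condLExp_mul_comp_le hF hρ hfresh hξm hKsq
  rw [hκl] at hbp' hbm'
  set κ := ∫ u, K u ^ 2 ∂unifInterval with hκdef
  have hκ0 : 0 ≤ κ := integral_nonneg fun u => by positivity
  set A : ℝ := 3 * ((d : ℝ) / (2 * h)) ^ 2 with hA
  have hA0 : 0 ≤ A := by positivity
  have h1 := condLExp_le_smul_add (F := F) (μ := μ)
    (X := fun ω => ENNReal.ofReal (‖g ω‖ ^ 2))
    (X₁ := fun ω => ENNReal.ofReal (‖g₀ ω‖ ^ 2))
    (X₂ := fun ω => ENNReal.ofReal (ξp ω ^ 2) * ENNReal.ofReal (K' (ρ ω).1 ^ 2))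
    (X₃ := fun ω => ENNReal.ofReal (ξm ω ^ 2) * ENNReal.ofReal (K' (ρ ω).1 ^ 2))
    (c₁ := ENNReal.ofReal 3) (c₂ := ENNReal.ofReal A) ENNReal.ofReal_ne_top
    ENNReal.ofReal_ne_top
    ((hξp.pow_const 2).ennreal_ofReal.mul (hK'r.pow_const 2).ennreal_ofReal).aemeasurable
    ((hξm.pow_const 2).ennreal_ofReal.mul (hK'r.pow_const 2).ennreal_ofReal).aemeasurable
    ?_ hbp' hbm'
  · filter_upwards [h1] with ω hω
    refine hω.trans (add_le_add (mul_le_mul_left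
      (ENNReal.ofReal_le_ofReal hC3) _) ?_)
    rw [← ENNReal.ofReal_mul (by positivity), ← ENNReal.ofReal_add (by positivity) (by positivity),
      ← ENNReal.ofReal_mul (by positivity)]
    refine ENNReal.ofReal_le_ofReal ?_
    calc A * (δ ^ 2 * κ + δ ^ 2 * κ) = 3 / 2 * κ * ((d : ℝ) ^ 2 / h ^ 2 * δ ^ 2) := by
          rw [hA]
          field_simp
          ring
      _ ≤ _ := by gcongr
  · filter_upwards [hKr] with ω hω
    rw [← ENNReal.ofReal_mul (by positivity), ← ENNReal.ofReal_mul (by positivity),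
      ← ENNReal.ofReal_mul (by positivity),
      ← ENNReal.ofReal_add (by positivity) (by positivity),
      ← ENNReal.ofReal_mul (by positivity),
      ← ENNReal.ofReal_add (by positivity) (by positivity), hg, hg₀, ← hω]
    exact ENNReal.ofReal_le_ofReal (sq_norm_twoPointEstimator_add_le K hh _ _ _ _ _ _)

end Estimator

theorem mainTheorem6 (β : ℝ) (hβ : 2 ≤ β) (K : ℝ → ℝ) (hK : IsSmoothingKernel β K) :
    -- the constant depends on the order `β` and on the kernel only
    ∃ C : ℝ, 0 < C ∧
      ∀ (d : ℕ) (_hd : 1 ≤ d) (L δ h : ℝ) (_hδ : 0 ≤ δ) (_hh : 0 < h)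
        (f : Eucl d → ℝ) (_hf : HolderSmooth β L f)
        (Ω : Type*) (m0 : MeasurableSpace Ω) (μ : Measure[m0] Ω) (_hμ : IsProbabilityMeasure μ)
        -- the history and the current iterate
        (F : MeasurableSpace Ω) (_hF : F ≤ m0)
        (x : Ω → Eucl d) (_hx : Measurable[F] x)
        -- the random scalar and the random direction, drawn independently of the history
        (r : Ω → ℝ) (ζ : Ω → Metric.sphere (0 : Eucl d) 1)
        (_hr : Measurable[m0] r) (_hζ : Measurable[m0] ζ)
        (_hr_unif : pdf.IsUniform r (Set.Icc (-1) 1) μ volume)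
        (_hζ_unif : pdf.IsUniform ζ Set.univ μ (volume : Measure (Eucl d)).toSphere)
        (_hrζ : IndepFun r ζ μ)
        (_hfresh : Indep F (MeasurableSpace.comap (fun ω => (r ω, ζ ω)) inferInstance) μ)
        -- the query points and the noise of the two queries
        (xp xm : Ω → Eucl d)
        (_hxp : ∀ ω, xp ω = queryPoint 1 h (r ω) (ζ ω) (x ω))
        (_hxm : ∀ ω, xm ω = queryPoint (-1) h (r ω) (ζ ω) (x ω))
        (ξp ξm : Ω → ℝ) (_hξp : Measurable[m0] ξp) (_hξm : Measurable[m0] ξm)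
        (_hnoise_p : HasNoiseLevel μ F xp ξp δ) (_hnoise_m : HasNoiseLevel μ F xm ξm δ)
        -- the estimator `g` and its noise-free counterpart `g₀`
        (g g₀ : Ω → Eucl d)
        (_hg : ∀ ω, g ω =
          twoPointEstimator K h (r ω) (ζ ω) (f (xp ω) + ξp ω) (f (xm ω) + ξm ω))
        (_hg₀ : ∀ ω, g₀ ω = twoPointEstimator K h (r ω) (ζ ω) (f (xp ω)) (f (xm ω))),
        -- the bias
        (∃ b : Ω → Eucl d, HasCondMean μ F g (fun ω => gradient f (x ω) + b ω) ∧
          ∀ᵐ ω ∂μ, ‖b ω‖ ≤ C * (L * h ^ (β - 1) + (d : ℝ) / h * δ)) ∧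
        -- the second moment, for a bounded kernel
        ((∃ M : ℝ, ∀ u ∈ Set.Icc (-1 : ℝ) 1, |K u| ≤ M) →
          ∀ᵐ ω ∂μ, μ⁻[fun ω' => ENNReal.ofReal (‖g ω'‖ ^ 2)|F] ω ≤
            ENNReal.ofReal (C * ((d : ℝ) ^ 2 / h ^ 2)) *
                μ⁻[fun ω' => ENNReal.ofReal (|f (xp ω') - f (xm ω')| ^ 2)|F] ω +
              ENNReal.ofReal (C * ((d : ℝ) ^ 2 / h ^ 2 * δ ^ 2))) ∧
        -- the second moment, for any kernel, if the noise has level `δ` given the query points too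
        (HasNoiseLevel μ (F ⊔ MeasurableSpace.comap (fun ω => (r ω, ζ ω)) inferInstance) xp ξp δ →
          HasNoiseLevel μ (F ⊔ MeasurableSpace.comap (fun ω => (r ω, ζ ω)) inferInstance) xm ξm δ →
          ∀ᵐ ω ∂μ, μ⁻[fun ω' => ENNReal.ofReal (‖g ω'‖ ^ 2)|F] ω ≤
            ENNReal.ofReal C * μ⁻[fun ω' => ENNReal.ofReal (‖g₀ ω'‖ ^ 2)|F] ω +
              ENNReal.ofReal (C * ((d : ℝ) ^ 2 / h ^ 2 * δ ^ 2))) := by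
  -- one bound `M`, chosen from the kernel before anything else; it is `0` for an unbounded kernel
  obtain ⟨M, hM⟩ : ∃ M : ℝ, (∃ M : ℝ, ∀ u ∈ Set.Icc (-1 : ℝ) 1, |K u| ≤ M) →
      ∀ u ∈ Set.Icc (-1 : ℝ) 1, |K u| ≤ M := by
    by_cases hb : ∃ M : ℝ, ∀ u ∈ Set.Icc (-1 : ℝ) 1, |K u| ≤ M
    · exact ⟨hb.choose, fun _ => hb.choose_spec⟩
    · exact ⟨0, fun h => absurd h hb⟩
  set κβ := ∫ u, |u| ^ β * |K u| ∂unifInterval with hκβ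
  set κ := ∫ u, K u ^ 2 ∂unifInterval with hκ
  have hκβ0 : 0 ≤ κβ := integral_nonneg fun u => by positivity
  have hκ0 : 0 ≤ κ := integral_nonneg fun u => by positivity
  refine ⟨2 * κβ + 3 * (1 + κ) + 3 / 2 * M ^ 2, by positivity, ?_⟩
  intro d hd L δ h hδ hh f hf Ω m0 μ hμ F hF x hx r ζ hr hζ hr_unif hζ_unif hrζ hfresh xp xm hxp hxm
    ξp ξm hξp hξm hnoise_p hnoise_m g g₀ hg hg₀
  have hM0 : 0 ≤ M ^ 2 := sq_nonneg M
  have hL := hf.nonneg hd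
  have hρ : Measurable[m0] fun ω => (r ω, ζ ω) := Measurable.prodMk hr hζ
  have hlaw := map_prodMk_eq_drawLaw hr hζ hr_unif hζ_unif hrζ
  have hm : F ⊔ MeasurableSpace.comap (fun ω => (r ω, ζ ω)) inferInstance ≤ m0 :=
    sup_le hF hρ.comap_le
  have hbp := hnoise_p.isTsybakovNoise hF
  have hbm := hnoise_m.isTsybakovNoise hF
  refine ⟨?_, fun hbdd => ?_, fun hnp hnm => ?_⟩
  · obtain ⟨b, hmean, hb⟩ := exists_hasCondMean_twoPointEstimator hd hβ hK hδ hh hf hF hx hρ hlaw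
      hfresh hξp hξm hbp hbm (g := g) fun ω => by
        rw [hg, twoPointEstimator_add, hxp, hxm]
        rfl
    refine ⟨b, hmean, hb.mono fun ω hω => hω.trans ?_⟩
    have p1 : 0 ≤ L * h ^ (β - 1) := by positivity
    have p2 : 0 ≤ (d : ℝ) / h * δ := by positivity
    calc 2 * L * h ^ (β - 1) * κβ + (d : ℝ) / (2 * h) * (δ * (1 + κ))
        = 2 * κβ * (L * h ^ (β - 1)) + (1 + κ) / 2 * ((d : ℝ) / h * δ) := by
          field_simp
      _ ≤ (2 * κβ + 3 * (1 + κ) + 3 / 2 * M ^ 2) * (L * h ^ (β - 1)) +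
          (2 * κβ + 3 * (1 + κ) + 3 / 2 * M ^ 2) * ((d : ℝ) / h * δ) :=
          add_le_add (mul_le_mul_of_nonneg_right (by linarith) p1)
            (mul_le_mul_of_nonneg_right (by linarith) p2)
      _ = _ := by ring
  · exact condLExp_sq_norm_le_of_bounded
      ((ae_comp_fst_of_ae_unifInterval hd hρ hlaw ae_unifInterval_mem_Icc).mono
        fun ω hω => hM hbdd _ hω) hh hξp hξm hbp hbm hg (by linarith)
  · exact condLExp_sq_norm_le_of_fresh hd hK.sq_integrable hh hF hρ hlaw hfresh hξp hξm
      (hnp.isTsybakovNoise hm) (hnm.isTsybakovNoise hm) hg hg₀ (by linarith) (by linarith)
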